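/- Let $G$ be a finite group and let $h\in G$ be an involution. Let $\widehat G$ be the set of irreducible complex representations of $G$ up to equivalence, with dimensions $d_\sigma$ and characters $\chi_\sigma$, and let $\Lambda:=\{\sigma\in\widehat G : |\chi_\sigma(h)|=d_\sigma\}$. Suppose that $$|G|^{1/2} > |\widehat G|^{1/2}\,\sum_{\sigma\in\Lambda} d_\sigma^2 .$$ Then any efficient algorithm operating on coset states that distinguishes between the case when the hidden subgroup of $G^n$ is a conjugate of $\langle (h,\dots,h)\rangle\le G^n$ and the case when the hidden subgroup is the identity subgroup of $G^n$ needs to make measurements entangled across $\Omega(n)$ registers. Precisely: for a finite group $K$ and $H\le K$ let $\sigma_H=\frac1{|K|}\sum_{g\in K}|gH\rangle\langle gH|$, where $|gH\rangle=|H|^{-1/2}\sum_{x\in gH}|x\rangle\in\mathbb C[K]$. An algorithm operating on coset states for $K$ applies a finite sequence of finite-outcome POVMs and then gives an output from a finite set; each POVM acts jointly on some number $m$ of fresh copies of $\sigma_H$ (that is, on $\sigma_H^{\otimes m}$), and the choice of each POVM, the decision to stop, and the output may depend on the outcomes observed so far. Its entanglement is the largest $m$ that occurs, and its number of coset states is the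 largest total number of copies used in a run. There is a constant $c>0$, depending only on $G$ and $h$, such that for all $a,b\in\mathbb N$ there is an $N$ with the following property. Let $n\ge N$, and consider an algorithm operating on coset states for $G^n$ that uses at most $n^a$ coset states and whose output distribution for the hidden subgroup $g\langle(h,\dots,h)\rangle g^{-1}$ has, for every $g\in G^n$, total variation distance at least $n^{-b}$ from its output distribution for the trivial hidden subgroup. Then the entanglement of the algorithm is at least $c\,n$. -/

import Mathlib

/-! Irreducible complex representations of a finite group, coset states, and adaptive measurements
of coset states that act jointly on a bounded number of registers. -/

namespace CosetHSP

/-! ### Irreducible representations -/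

/-- An irreducible complex representation on a coordinate space `ℂ ^ dim`. -/
structure Irrep (G : Type*) [Group G] where
  dim : ℕ
  rep : Representation ℂ G (Fin dim → ℂ)
  irreducible : rep.IsIrreducible

/-- Equivalence of irreducible representations. -/
instance irrepSetoid (G : Type*) [Group G] : Setoid (Irrep G) where
  r ρ σ := Nonempty (ρ.rep.Equiv σ.rep)
  iseqv :=
    { refl := fun _ => ⟨Representation.Equiv.refl _⟩
      symm := fun ⟨e⟩ => ⟨e.symm⟩
      trans := fun ⟨e⟩ ⟨f⟩ => ⟨e.trans f⟩ }

/-- The set `Ĝ` of equivalence classes of irreducible complex representations of `G`. -/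
abbrev IrrepClass (G : Type*) [Group G] : Type _ := Quotient (irrepSetoid G)

/-- The dimension `d_σ`. -/
def IrrepClass.dim {G : Type*} [Group G] (σ : IrrepClass G) : ℕ :=
  Quotient.lift (fun ρ : Irrep G => ρ.dim)
    (by rintro ρ τ ⟨e⟩; simpa using e.toLinearEquiv.finrank_eq) σ

/-- The character `χ_σ`. -/
noncomputable def IrrepClass.character {G : Type*} [Group G] (σ : IrrepClass G) : G → ℂ :=
  Quotient.lift (fun ρ : Irrep G => ρ.rep.character)
    (by rintro ρ τ ⟨e⟩; exact Representation.char_iso e) σ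

theorem IrrepClass.orthonormal {G : Type*} [Group G] [Fintype G] (σ τ : IrrepClass G) :
    (Nat.card G : ℂ)⁻¹ * ∑ g : G, σ.character g * τ.character g⁻¹ =
      (open Classical in if σ = τ then 1 else 0) := by
  classical
  induction σ using Quotient.inductionOn with | _ ρ =>
  induction τ using Quotient.inductionOn with | _ π =>
  have := ρ.irreducible
  have := π.irreducible
  have : Invertible (Nat.card G : ℂ) :=
    invertibleOfNonzero (Nat.cast_ne_zero.mpr Nat.card_pos.ne')
  have h := Representation.char_orthonormal ρ.rep π.rep
  refine Eq.trans h ?_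
  have hiff : Nonempty (π.rep.Equiv ρ.rep) ↔
      (Quotient.mk (irrepSetoid G) ρ = Quotient.mk (irrepSetoid G) π) := by
    rw [Quotient.eq]
    exact ⟨fun ⟨e⟩ => ⟨e.symm⟩, fun ⟨e⟩ => ⟨e.symm⟩⟩
  by_cases hc : Nonempty (π.rep.Equiv ρ.rep)
  · rw [if_pos hc, if_pos (hiff.mp hc)]
  · rw [if_neg hc, if_neg (fun h => hc (hiff.mpr h))]

/-- A finite group has finitely many irreducible representations up to equivalence. -/
instance IrrepClass.finite {G : Type*} [Group G] [Fintype G] : Finite (IrrepClass G) := by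
  classical
  have hli : LinearIndependent ℂ (fun σ : IrrepClass G => σ.character) := by
    rw [linearIndependent_iff']
    intro s c hc τ hτ
    have key : (Nat.card G : ℂ)⁻¹ * ∑ g : G, (∑ σ ∈ s, c σ • σ.character) g * τ.character g⁻¹
        = c τ := by
      have : ∀ g : G, (∑ σ ∈ s, c σ • σ.character) g * τ.character g⁻¹
          = ∑ σ ∈ s, c σ * (σ.character g * τ.character g⁻¹) := by
        intro g
        simp [Finset.sum_apply, Finset.sum_mul, mul_assoc]
      simp_rw [this]
      rw [Finset.sum_comm, Finset.mul_sum]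
      have h2 : ∀ σ ∈ s, (Nat.card G : ℂ)⁻¹ *
          ∑ g : G, c σ * (σ.character g * τ.character g⁻¹) = if σ = τ then c σ else 0 := by
        intro σ _
        rw [← Finset.mul_sum, mul_left_comm, IrrepClass.orthonormal]
        split_ifs <;> simp
      rw [Finset.sum_congr rfl h2]
      simp [hτ]
    rw [hc] at key
    simpa using key.symm
  exact hli.finite

noncomputable instance {G : Type*} [Group G] [Fintype G] : Fintype (IrrepClass G) :=
  Fintype.ofFinite _

open Classical in
/-- The set `Λ` of irreducible representations `σ` with `|χ_σ(h)| = d_σ`. -/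
noncomputable def extremalIrreps {G : Type*} [Group G] [Fintype G] (h : G) :
    Finset (IrrepClass G) :=
  {σ | ‖σ.character h‖ = σ.dim}

/-! ### Coset states -/

open Classical in
/-- The coset state vector `|gH⟩ = |H|^{-1/2} ∑_{x ∈ gH} |x⟩` in `ℂ[G]`. -/
noncomputable def cosetVector {G : Type*} [Group G] (H : Subgroup G) (g : G) : G → ℂ :=
  fun x => if g⁻¹ * x ∈ H then (((Real.sqrt (Nat.card H))⁻¹ : ℝ) : ℂ) else 0

/-- The density matrix `σ_H = |G|⁻¹ ∑_g |gH⟩⟨gH|`. -/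
noncomputable def cosetState {G : Type*} [Group G] [Fintype G] (H : Subgroup G) :
    Matrix G G ℂ :=
  (Fintype.card G : ℂ)⁻¹ •
    ∑ g : G, Matrix.vecMulVec (cosetVector H g) (star (cosetVector H g))

/-- The `m`-fold tensor power of a matrix, on the basis of `m`-tuples of basis labels. -/
def tensorPower {X : Type*} (m : ℕ) (A : Matrix X X ℂ) :
    Matrix (Fin m → X) (Fin m → X) ℂ :=
  Matrix.of fun x y => ∏ i, A (x i) (y i)

/-! ### Measurements and algorithms -/

open scoped ComplexOrder in
/-- A POVM with `r` outcomes on the space `ℂ ^ X`. -/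
structure POVM (X : Type*) [Fintype X] [DecidableEq X] (r : ℕ) where
  effect : Fin r → Matrix X X ℂ
  posSemidef : ∀ i, (effect i).PosSemidef
  sum_eq_one : ∑ i, effect i = 1

/-- The Born rule: the probability `tr (s Eᵢ)` of outcome `i` in the state `s`. -/
noncomputable def POVM.prob {X : Type*} [Fintype X] [DecidableEq X] {r : ℕ} (M : POVM X r)
    (s : Matrix X X ℂ) (i : Fin r) : ℝ :=
  (s * M.effect i).trace.re

/-- An algorithm operating on coset states for a hidden subgroup of `G`, with outputs in `α`: it
either stops with an output, or applies a POVM jointly to `m` fresh coset states and goes on in a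
way that may depend on the observed outcome. Measurements with `m = 0` provide classical
randomness. -/
inductive CosetAlgorithm (G : Type*) [Fintype G] [DecidableEq G] (α : Type*)
  | output (a : α) : CosetAlgorithm G α
  | measure (m r : ℕ) (M : POVM (Fin m → G) r) (next : Fin r → CosetAlgorithm G α) :
      CosetAlgorithm G α

namespace CosetAlgorithm

variable {G : Type*} [Fintype G] [DecidableEq G] {α : Type*}

/-- The largest number of registers on which a single measurement of the algorithm acts. -/
def entanglement : CosetAlgorithm G α → ℕ
  | output _ => 0
  | measure m _ _ next => max m (Finset.univ.sup fun i => (next i).entanglement)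

/-- The largest total number of coset states used along a run of the algorithm. -/
def numStates : CosetAlgorithm G α → ℕ
  | output _ => 0
  | measure m _ _ next => m + Finset.univ.sup fun i => (next i).numStates

/-- The probability that the algorithm outputs `a` when the hidden subgroup is `H`. -/
noncomputable def outputProb [Group G] [DecidableEq α] (H : Subgroup G) :
    CosetAlgorithm G α → α → ℝ
  | output b, a => if b = a then 1 else 0
  | measure m _ M next, a =>
      ∑ i, M.prob (tensorPower m (cosetState H)) i * (next i).outputProb H a

/-- The total variation distance between the output distributions of the algorithm for the hidden
subgroups `H` and `K`. -/
noncomputable def totalVariation [Group G] [Fintype α] [DecidableEq α] (A : CosetAlgorithm G α)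
    (H K : Subgroup G) : ℝ :=
  (1 / 2) * ∑ a, |A.outputProb H a - A.outputProb K a|

/-- The algorithm distinguishes, with advantage at least `δ`, every conjugate of `H` as the hidden
subgroup from the trivial hidden subgroup. For `α = Bool`, an algorithm which answers correctly
with probability at least `2/3` in all cases does so with `δ = 1/3`. -/
def Distinguishes [Group G] [Fintype α] [DecidableEq α] (A : CosetAlgorithm G α)
    (H : Subgroup G) (δ : ℝ) : Prop :=
  ∀ g : G, δ ≤ A.totalVariation (H.map (MulAut.conj g).toMonoidHom) ⊥

end CosetAlgorithm

end CosetHSP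

namespace CosetHSP

open Matrix Finset
open scoped ComplexOrder

/-! Let `K = G ^ n` and let `t` be the constant tuple. For the hidden subgroup generated by a
conjugate of `t`, one register is `|K|⁻¹ (1 + R)`, with `R` the right translation by that conjugate.
So `m` registers expand into `2 ^ m` terms indexed by subsets `S` of registers, and `S = ∅` is
exactly the state of the trivial subgroup. For nonempty `S`, outcome `i` contributes the value at
the conjugate of a positive definite function `f i` on `K`, and the `f i` sum to the point mass at
`1` because the effects sum to `1`. It remains to show that such a resolution of the point mass has
small `ℓ¹` norm on average over the conjugacy class of `t` (`FourierData.sum_conj_norm_le`).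

Fourier inversion writes `f i` as a sum of `tr (B ρ_s)` with `B ≥ 0`, and the traces of the `B` at
`s` total `d_s² / |K|`. The second moment of `tr (B ρ_s)` over the class
(`FourierData.sum_conj_norm_trace_sq_le`) comes from `F = |tr (B ρ_s)|²`, which is again positive
definite, so its pairings `c τ` with the characters are nonnegative. They satisfy `∑ d_τ c_τ = |K|
(tr B)²`, and by Schur orthogonality also `c_τ ≤ d_τ |K| (tr B)² / d_s`. The first bound serves the
`τ` whose ratio `|χ_τ(t)| / d_τ` is at most a threshold `a`, the second the remaining ones.
Cauchy–Schwarz over the class and over `s` then assembles the pieces.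

The bound is multiplicative over powers of `G`. For a large exponent `k` and a threshold below `1`
but close to it, its base is close to `∑_Λ d_σ² · ∑ d_σ / |G|`, which is below `1` by hypothesis,
since `∑ d_σ ≤ (|Ĝ| |G|)^{1/2}`. This gives exponential decay (`exists_exponential_bound`). A hybrid
argument along the adaptive run costs a factor `numStates * 2 ^ entanglement`, so a polynomial
advantage from polynomially many states forces linear entanglement. -/

open scoped MatrixOrder Matrix.Norms.L2Operator in
theorem _root_.Matrix.PosSemidef.exists_eq_conjTranspose_mul_self {κ : Type*} [Fintype κ]
    [DecidableEq κ] {E : Matrix κ κ ℂ} (hE : E.PosSemidef) : ∃ A : Matrix κ κ ℂ, E = Aᴴ * A :=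
  CStarAlgebra.nonneg_iff_eq_star_mul_self.mp hE.nonneg

/-! ### Positive definite functions -/

/-- A function `f` on a group is positive definite if the kernel `(y, z) ↦ f (y⁻¹ z)` is. -/
def IsPosDefFun {K : Type*} [Group K] (f : K → ℂ) : Prop :=
  (Matrix.of fun y z => f (y⁻¹ * z)).PosSemidef

namespace IsPosDefFun

variable {K : Type*} [Group K] {f f' : K → ℂ}

theorem mul (hf : IsPosDefFun f) (hf' : IsPosDefFun f') : IsPosDefFun fun y => f y * f' y :=
  PosSemidef.hadamard hf hf'

theorem star_apply (hf : IsPosDefFun f) (y : K) : star (f y) = f y⁻¹ := by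
  simpa using hf.isHermitian.apply y 1

theorem conj (hf : IsPosDefFun f) : IsPosDefFun fun y => star (f y) := by
  have h := PosSemidef.transpose hf
  have h2 : (Matrix.of fun y z => f (y⁻¹ * z))ᵀ = Matrix.of fun y z => star (f (y⁻¹ * z)) := by
    ext y z
    simp [hf.star_apply]
  rwa [h2] at h

/-- The quadratic form of the kernel at the all-ones vector is `|K|` times this sum. -/
theorem sum_nonneg [Fintype K] (hf : IsPosDefFun f) : 0 ≤ ∑ y, f y := by
  have h := hf.dotProduct_mulVec_nonneg (fun _ => 1)
  have h2 : star (fun _ => (1 : ℂ)) ⬝ᵥ ((Matrix.of fun y z => f (y⁻¹ * z)) *ᵥ fun _ => 1) =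
      (Fintype.card K : ℂ) * ∑ y, f y := by
    simp only [dotProduct, mulVec, Pi.star_apply, star_one, one_mul, of_apply, mul_one]
    rw [Finset.sum_congr rfl fun y _ =>
      Fintype.sum_equiv (Equiv.mulLeft y⁻¹) (fun z => f (y⁻¹ * z)) f fun _ => rfl]
    simp
  rw [h2] at h
  have hpos : (0 : ℂ) < Fintype.card K := by exact_mod_cast Fintype.card_pos
  have h3 := mul_nonneg (inv_nonneg.mpr hpos.le) h
  rwa [inv_mul_cancel_left₀ hpos.ne'] at h3

/-- Diagonal-type coefficients `y ↦ tr (E U(y))` of a unitary representation are positive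
definite. -/
theorem trace_mul [Finite K] {κ : Type*} [Fintype κ] [DecidableEq κ] (U : K →* Matrix κ κ ℂ)
    (hU : ∀ y, U y⁻¹ = (U y)ᴴ) {E : Matrix κ κ ℂ} (hE : E.PosSemidef) :
    IsPosDefFun fun y => (E * U y).trace := by
  obtain ⟨A, rfl⟩ := hE.exists_eq_conjTranspose_mul_self
  -- The kernel is the Gram matrix of the flattened matrices `U y * Aᴴ`, which are the columns of
  -- `N`.
  let N : Matrix (κ × κ) K ℂ := Matrix.of fun p y => (U y * Aᴴ) p.1 p.2
  have h := posSemidef_conjTranspose_mul_self N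
  unfold IsPosDefFun
  convert h using 1
  ext y z
  have h1 : (Aᴴ * A * U (y⁻¹ * z)).trace = ((U y * Aᴴ)ᴴ * (U z * Aᴴ)).trace := by
    rw [map_mul, hU, conjTranspose_mul, conjTranspose_conjTranspose, Matrix.mul_assoc,
      Matrix.trace_mul_comm]
    simp only [Matrix.mul_assoc]
  change (Aᴴ * A * U (y⁻¹ * z)).trace = (Nᴴ * N) y z
  rw [h1, mul_apply, Fintype.sum_prod_type_right]
  rw [trace]
  refine Finset.sum_congr rfl fun i _ => ?_
  rw [diag_apply, mul_apply]
  rfl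

end IsPosDefFun

/-- With `B = Aᴴ * A`, entries are inner products of columns of `A`, and Cauchy–Schwarz bounds each
by the product of the column norms. -/
theorem norm_trace_mul_self_le {κ : Type*} [Fintype κ] {B : Matrix κ κ ℂ} (hB : B.PosSemidef) :
    ∑ a, ∑ b, ‖B a b‖ ^ 2 ≤ B.trace.re ^ 2 := by
  classical
  obtain ⟨A, rfl⟩ := hB.exists_eq_conjTranspose_mul_self
  have htr : (Aᴴ * A).trace.re = ∑ a, ∑ k, ‖A k a‖ ^ 2 := by
    simp only [trace, diag_apply, mul_apply, conjTranspose_apply, Complex.re_sum]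
    refine Finset.sum_congr rfl fun a _ => Finset.sum_congr rfl fun k _ => ?_
    rw [mul_comm, Complex.star_def, Complex.mul_conj, Complex.normSq_eq_norm_sq]
    norm_cast
  rw [htr, sq, Finset.sum_mul_sum]
  refine Finset.sum_le_sum fun a _ => Finset.sum_le_sum fun b _ => ?_
  calc ‖(Aᴴ * A) a b‖ ^ 2 ≤ (∑ k, ‖A k a‖ * ‖A k b‖) ^ 2 := by
        gcongr
        rw [mul_apply]
        refine (norm_sum_le _ _).trans (le_of_eq ?_)
        simp
    _ ≤ _ := Finset.sum_mul_sq_le_sq_mul_sq _ _ _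

/-! ### Unitary matrix coefficients forming an orthogonal basis -/

/-- A family of unitary matrix representations of a finite group whose coefficients satisfy the
Schur orthogonality relations and whose characters decompose the regular character. -/
structure FourierData (K : Type*) [Group K] [Fintype K] [DecidableEq K] {S : Type*} [Fintype S]
    (ι : S → Type*) [∀ s, Fintype (ι s)] [∀ s, DecidableEq (ι s)] where
  rep : ∀ s, K →* Matrix (ι s) (ι s) ℂ
  rep_inv : ∀ s y, rep s y⁻¹ = (rep s y)ᴴ
  schur : ∀ s a b a' b', ∑ y, rep s y a b * star (rep s y a' b') =
    if a = a' ∧ b = b' then (Fintype.card K : ℂ) / Fintype.card (ι s) else 0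
  complete : ∀ y, ∑ s, (Fintype.card (ι s) : ℂ) * (rep s y).trace =
    if y = 1 then (Fintype.card K : ℂ) else 0

namespace FourierData

variable {K : Type*} [Group K] [Fintype K] [DecidableEq K] {S : Type*} [Fintype S]
  {ι : S → Type*} [∀ s, Fintype (ι s)] [∀ s, DecidableEq (ι s)] (D : FourierData K ι)

/-- The character of a member of the family. -/
noncomputable def chi (s : S) (y : K) : ℂ := (D.rep s y).trace

theorem chi_inv (s : S) (y : K) : D.chi s y⁻¹ = star (D.chi s y) := by
  rw [chi, rep_inv, trace_conjTranspose, chi]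

theorem rep_mem_unitary (s : S) (y : K) : D.rep s y ∈ unitaryGroup (ι s) ℂ := by
  rw [mem_unitaryGroup_iff, star_eq_conjTranspose, ← rep_inv, ← map_mul, mul_inv_cancel, map_one]

theorem norm_chi_le (s : S) (y : K) : ‖D.chi s y‖ ≤ Fintype.card (ι s) := by
  refine (norm_sum_le _ _).trans ?_
  refine (Finset.sum_le_sum fun a _ =>
    entry_norm_bound_of_unitary (D.rep_mem_unitary s y) a a).trans ?_
  simp

theorem sum_card_sq (D : FourierData K ι) : ∑ s, (Fintype.card (ι s) : ℝ) ^ 2 = Fintype.card K := by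
  have h := D.complete 1
  simp only [map_one, trace_one, if_true] at h
  have h2 : ((∑ s, (Fintype.card (ι s) : ℝ) ^ 2 : ℝ) : ℂ) = ((Fintype.card K : ℝ) : ℂ) := by
    push_cast
    rw [← h]
    exact Finset.sum_congr rfl fun s _ => sq _
  exact_mod_cast h2

/-- A class sum acts as a scalar; here this is read off from the orthogonality of the matrix
coefficients. -/
theorem sum_rep_conj (s : S) (y : K) : ∑ g, D.rep s (g * y * g⁻¹) =
    ((Fintype.card K : ℂ) / Fintype.card (ι s) * D.chi s y) • (1 : Matrix (ι s) (ι s) ℂ) := by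
  ext a b
  have h1 : ∀ g, D.rep s (g * y * g⁻¹) a b =
      ∑ e, ∑ c, D.rep s y c e * (D.rep s g a c * star (D.rep s g b e)) := by
    intro g
    rw [map_mul, map_mul, rep_inv, mul_apply]
    refine Finset.sum_congr rfl fun e _ => ?_
    rw [mul_apply, Finset.sum_mul]
    refine Finset.sum_congr rfl fun c _ => ?_
    rw [conjTranspose_apply]
    ring
  rw [Matrix.sum_apply, Finset.sum_congr rfl fun g _ => h1 g, Finset.sum_comm]
  rw [Finset.sum_congr rfl fun e _ => Finset.sum_comm]
  simp_rw [← Finset.mul_sum, D.schur]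
  rw [Matrix.smul_apply, one_apply, chi, trace]
  by_cases hab : a = b
  · simp [hab, Finset.mul_sum, mul_comm]
  · simp [hab]

/-- Second orthogonality of characters: average `complete` at `x * (g * y⁻¹ * g⁻¹)` over `g`; by
`sum_rep_conj` each summand factors into two characters. -/
theorem sum_chi_mul_star_chi (x y : K) :
    ∑ s, D.chi s x * star (D.chi s y) = ∑ g : K, if x = g * y * g⁻¹ then 1 else 0 := by
  have hK : (Fintype.card K : ℂ) ≠ 0 := by exact_mod_cast Fintype.card_ne_zero
  apply mul_left_cancel₀ hK
  have h1 : ∀ s, (Fintype.card K : ℂ) * (D.chi s x * star (D.chi s y)) =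
      Fintype.card (ι s) * ∑ g : K, D.chi s (x * (g * y⁻¹ * g⁻¹)) := by
    intro s
    have h2 : ∑ g : K, D.chi s (x * (g * y⁻¹ * g⁻¹)) =
        (Fintype.card K : ℂ) / Fintype.card (ι s) * D.chi s y⁻¹ * D.chi s x := by
      simp only [chi, map_mul (D.rep s) x]
      rw [← trace_sum, ← Finset.mul_sum, sum_rep_conj, Matrix.mul_smul, trace_smul, mul_one,
        smul_eq_mul, chi]
    rw [h2, chi_inv]
    -- `FourierData` permits zero-dimensional members; their characters vanish, and division by zero
    -- gives `0`.
    by_cases hd : Fintype.card (ι s) = 0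
    · have : IsEmpty (ι s) := Fintype.card_eq_zero_iff.mp hd
      simp [chi, trace]
    · have : (Fintype.card (ι s) : ℂ) ≠ 0 := by exact_mod_cast hd
      field_simp
  rw [Finset.mul_sum, Finset.sum_congr rfl fun s _ => h1 s]
  simp_rw [Finset.mul_sum]
  rw [Finset.sum_comm]
  refine Finset.sum_congr rfl fun g _ => ?_
  have h3 : ∑ s, (Fintype.card (ι s) : ℂ) * D.chi s (x * (g * y⁻¹ * g⁻¹)) = _ := D.complete _
  rw [h3]
  have : x * (g * y⁻¹ * g⁻¹) = 1 ↔ x = g * y * g⁻¹ := by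
    rw [mul_eq_one_iff_eq_inv]
    simp [mul_assoc]
  simp [this]

/-- Turns a sum over a conjugacy class into character pairings of `F`, which positive definiteness
controls. -/
theorem sum_conj_eq (F : K → ℂ) (t : K) :
    ∑ g, F (g * t * g⁻¹) = ∑ s, star (D.chi s t) * ∑ y, F y * D.chi s y := by
  have h1 : ∀ g, F (g * t * g⁻¹) = ∑ y, if y = g * t * g⁻¹ then F y else 0 := by simp
  rw [Finset.sum_congr rfl fun g _ => h1 g, Finset.sum_comm]
  simp_rw [Finset.mul_sum]
  rw [Finset.sum_comm (s := (univ : Finset S))]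
  refine Finset.sum_congr rfl fun y _ => ?_
  have h2 := D.sum_chi_mul_star_chi y t
  calc _ = F y * ∑ g : K, (if y = g * t * g⁻¹ then (1 : ℂ) else 0) := by
        rw [Finset.mul_sum]; simp
    _ = _ := by
        rw [← h2, Finset.mul_sum]
        exact Finset.sum_congr rfl fun s _ => by ring

theorem isPosDefFun_chi (s : S) : IsPosDefFun (D.chi s) := by
  have h := IsPosDefFun.trace_mul (D.rep s) (D.rep_inv s) PosSemidef.one
  simp only [one_mul] at h
  exact h

theorem sum_norm_trace_sq (s : S) (B : Matrix (ι s) (ι s) ℂ) :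
    ∑ y, ‖(B * D.rep s y).trace‖ ^ 2 =
      (Fintype.card K : ℝ) / Fintype.card (ι s) * ∑ a, ∑ b, ‖B a b‖ ^ 2 := by
  have h : ((∑ y, ‖(B * D.rep s y).trace‖ ^ 2 : ℝ) : ℂ) =
      (((Fintype.card K : ℝ) / Fintype.card (ι s) * ∑ a, ∑ b, ‖B a b‖ ^ 2 : ℝ) : ℂ) := by
    push_cast
    have h1 : ∀ y, (‖(B * D.rep s y).trace‖ : ℂ) ^ 2 = ∑ a, ∑ b, ∑ a', ∑ b',
        B a b * star (B a' b') * (D.rep s y b a * star (D.rep s y b' a')) := by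
      intro y
      rw [← Complex.conj_mul', mul_comm, ← Complex.star_def]
      simp only [trace, diag_apply, mul_apply, star_sum, star_mul', Finset.sum_mul]
      refine Finset.sum_congr rfl fun a _ => Finset.sum_congr rfl fun b _ => ?_
      simp only [Finset.mul_sum]
      refine Finset.sum_congr rfl fun a' _ => Finset.sum_congr rfl fun b' _ => ?_
      ring
    rw [Finset.sum_congr rfl fun y _ => h1 y, Finset.sum_comm, Finset.mul_sum]
    refine Finset.sum_congr rfl fun a _ => ?_
    rw [Finset.sum_comm, Finset.mul_sum]
    refine Finset.sum_congr rfl fun b _ => ?_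
    rw [Finset.sum_comm]
    have h2 : ∀ a' b', (B a b * star (B a' b') *
        if b = b' ∧ a = a' then (Fintype.card K : ℂ) / Fintype.card (ι s) else 0) =
        if a = a' then if b = b' then
          B a b * star (B a b) * ((Fintype.card K : ℂ) / Fintype.card (ι s)) else 0 else 0 := by
      intro a' b'
      by_cases h3 : a = a' <;> by_cases h4 : b = b' <;> simp [h3, h4]
    have h3 : ∀ a', ∑ y, ∑ b', B a b * star (B a' b') *
        (D.rep s y b a * star (D.rep s y b' a')) = if a = a' then
          B a b * star (B a b) * ((Fintype.card K : ℂ) / Fintype.card (ι s)) else 0 := by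
      intro a'
      rw [Finset.sum_comm]
      refine (Finset.sum_congr rfl fun b' _ => ?_).trans (b := ∑ b', if a = a' then if b = b' then
          B a b * star (B a b) * ((Fintype.card K : ℂ) / Fintype.card (ι s)) else 0 else 0) ?_
      · rw [← Finset.mul_sum, D.schur, h2]
      · by_cases h4 : a = a' <;> simp [h4]
    rw [Finset.sum_congr rfl fun a' _ => h3 a', Finset.sum_ite_eq, if_pos (Finset.mem_univ _)]
    rw [← Complex.conj_mul', ← Complex.star_def]
    ring
  exact_mod_cast h

/-- The second moment, over a conjugacy class, of a diagonal-type coefficient. -/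
theorem sum_conj_norm_trace_sq_le (s : S) {B : Matrix (ι s) (ι s) ℂ} (hB : B.PosSemidef) (t : K)
    {a : ℝ} (ha : 0 < a) (k : ℕ) :
    ∑ g, ‖(B * D.rep s (g * t * g⁻¹)).trace‖ ^ 2 ≤ Fintype.card K * B.trace.re ^ 2 *
      (a + (∑ τ, (Fintype.card (ι τ) : ℝ) ^ 2 *
        (‖D.chi τ t‖ / Fintype.card (ι τ) / a) ^ k) / Fintype.card (ι s)) := by
  set F : K → ℂ := fun y => (B * D.rep s y).trace * star (B * D.rep s y).trace with hF
  have hFpos : IsPosDefFun F :=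
    (IsPosDefFun.trace_mul (D.rep s) (D.rep_inv s) hB).mul
      (IsPosDefFun.trace_mul (D.rep s) (D.rep_inv s) hB).conj
  have hFnorm : ∀ y, F y = ((‖(B * D.rep s y).trace‖ ^ 2 : ℝ) : ℂ) := by
    intro y
    rw [hF]
    push_cast
    rw [← Complex.conj_mul', mul_comm, ← Complex.star_def]
  set c : S → ℂ := fun τ => ∑ y, F y * D.chi τ y with hc
  have hcnn : ∀ τ, 0 ≤ c τ := fun τ => (hFpos.mul (D.isPosDefFun_chi τ)).sum_nonneg
  have hcre : ∀ τ, c τ = ((c τ).re : ℂ) := fun τ => (Complex.eq_re_of_ofReal_le (hcnn τ))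
  have hcre0 : ∀ τ, 0 ≤ (c τ).re := fun τ => (Complex.nonneg_iff.mp (hcnn τ)).1
  have hcnorm : ∀ τ, ‖c τ‖ = (c τ).re := fun τ => by
    rw [hcre τ, Complex.norm_real, Real.norm_of_nonneg (hcre0 τ), Complex.ofReal_re]
  have hsumsq := D.sum_norm_trace_sq s B
  have hBB := norm_trace_mul_self_le hB
  -- First bound: `‖χ_τ‖ ≤ d_τ` pointwise, and the total mass of `F` is given by Schur
  -- orthogonality.
  have hle : ∀ τ, (c τ).re ≤ Fintype.card (ι τ) *
      ((Fintype.card K : ℝ) / Fintype.card (ι s) * B.trace.re ^ 2) := by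
    intro τ
    rw [← hcnorm]
    calc ‖c τ‖ ≤ ∑ y, ‖(B * D.rep s y).trace‖ ^ 2 * Fintype.card (ι τ) := by
          refine (norm_sum_le _ _).trans (Finset.sum_le_sum fun y _ => ?_)
          rw [norm_mul, hFnorm, Complex.norm_real, Real.norm_of_nonneg (by positivity)]
          gcongr
          exact D.norm_chi_le τ y
      _ ≤ _ := by
          rw [← Finset.sum_mul, hsumsq, mul_comm]
          gcongr
  -- Second bound: weighted by dimensions, the characters add up to the regular character, which
  -- picks out `F 1`.
  have hsum : ∑ τ, (Fintype.card (ι τ) : ℝ) * (c τ).re = Fintype.card K * B.trace.re ^ 2 := by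
    have h1 : ∑ τ, (Fintype.card (ι τ) : ℂ) * c τ = Fintype.card K * F 1 := by
      simp only [hc, Finset.mul_sum]
      rw [Finset.sum_comm]
      have h2 : ∀ y, ∑ τ, (Fintype.card (ι τ) : ℂ) * (F y * D.chi τ y) =
          F y * if y = 1 then (Fintype.card K : ℂ) else 0 := by
        intro y
        rw [← D.complete y, Finset.mul_sum]
        exact Finset.sum_congr rfl fun τ _ => by rw [chi]; ring
      rw [Finset.sum_congr rfl fun y _ => h2 y]
      simp [mul_comm]
    have hB1 : B.trace = (B.trace.re : ℂ) := Complex.eq_re_of_ofReal_le hB.trace_nonneg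
    have h3 : F 1 = ((B.trace.re ^ 2 : ℝ) : ℂ) := by
      rw [hFnorm, map_one, mul_one, hB1, Complex.norm_real, Complex.ofReal_re, Real.norm_eq_abs,
        sq_abs]
    rw [h3] at h1
    have h4 := congrArg Complex.re h1
    rw [Complex.re_sum] at h4
    rw [Finset.sum_congr rfl fun τ _ => show (Fintype.card (ι τ) : ℝ) * (c τ).re =
      ((Fintype.card (ι τ) : ℂ) * c τ).re by simp]
    rw [h4, ← Complex.ofReal_natCast, ← Complex.ofReal_mul, Complex.ofReal_re]
  have hmain : ∑ g, ‖(B * D.rep s (g * t * g⁻¹)).trace‖ ^ 2 ≤ ∑ τ, ‖D.chi τ t‖ * (c τ).re := by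
    have h1 : ((∑ g, ‖(B * D.rep s (g * t * g⁻¹)).trace‖ ^ 2 : ℝ) : ℂ) =
        ∑ τ, star (D.chi τ t) * c τ := by
      rw [← D.sum_conj_eq F t, Complex.ofReal_sum]
      exact Finset.sum_congr rfl fun g _ => (hFnorm _).symm
    have h2 : (∑ g, ‖(B * D.rep s (g * t * g⁻¹)).trace‖ ^ 2 : ℝ) =
        ‖((∑ g, ‖(B * D.rep s (g * t * g⁻¹)).trace‖ ^ 2 : ℝ) : ℂ)‖ := by
      rw [Complex.norm_real, Real.norm_of_nonneg]
      positivity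
    rw [h2, h1]
    refine (norm_sum_le _ _).trans (le_of_eq ?_)
    simp [hcnorm]
  refine hmain.trans ?_
  set r : S → ℝ := fun τ => ‖D.chi τ t‖ / Fintype.card (ι τ) with hr
  have hr0 : ∀ τ, 0 ≤ r τ := fun τ => by positivity
  have hr1 : ∀ τ, r τ ≤ 1 := fun τ => div_le_one_of_le₀ (D.norm_chi_le τ t) (by positivity)
  have hchi : ∀ τ, ‖D.chi τ t‖ ≤ Fintype.card (ι τ) * r τ := by
    intro τ
    by_cases hd : (Fintype.card (ι τ) : ℝ) = 0
    · have := D.norm_chi_le τ t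
      rw [hd] at this ⊢
      simpa using this
    · rw [hr, mul_div_cancel₀ _ hd]
  -- A smooth form of the threshold at `a`: above it the power is at least `1 ≥ r τ`. Unlike a sharp
  -- cutoff, this power is multiplicative over tensor products.
  have hrk : ∀ τ, r τ ≤ a + (r τ / a) ^ k := by
    intro τ
    by_cases h1 : r τ ≤ a
    · have : 0 ≤ (r τ / a) ^ k := pow_nonneg (div_nonneg (hr0 τ) ha.le) k
      linarith
    · have : 1 ≤ (r τ / a) ^ k := one_le_pow₀ ((one_le_div ha).mpr (not_le.mp h1).le)
      linarith [hr1 τ]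
  calc ∑ τ, ‖D.chi τ t‖ * (c τ).re
      ≤ ∑ τ, (Fintype.card (ι τ) * (c τ).re * a + (r τ / a) ^ k * (Fintype.card (ι τ) *
        (Fintype.card (ι τ) *
          ((Fintype.card K : ℝ) / Fintype.card (ι s) * B.trace.re ^ 2)))) := by
        refine Finset.sum_le_sum fun τ _ => ?_
        calc ‖D.chi τ t‖ * (c τ).re
            ≤ Fintype.card (ι τ) * (a + (r τ / a) ^ k) * (c τ).re := by
              gcongr
              · exact hcre0 τ
              · exact (hchi τ).trans (by gcongr; exact hrk τ)
          _ = Fintype.card (ι τ) * (c τ).re * a +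
              (r τ / a) ^ k * (Fintype.card (ι τ) * (c τ).re) := by ring
          _ ≤ _ := by
              have : 0 ≤ (r τ / a) ^ k := pow_nonneg (div_nonneg (hr0 τ) ha.le) k
              gcongr
              exact hle τ
    _ = _ := by
        rw [Finset.sum_add_distrib, ← Finset.sum_mul, hsum, mul_add, Finset.sum_div,
          Finset.mul_sum]
        congr 1
        refine Finset.sum_congr rfl fun τ _ => ?_
        ring

/-- The Fourier coefficient of a function on `K`, so that `f y = ∑ s, tr (f̂ s * rep s y)`. -/
noncomputable def coeff (f : K → ℂ) (s : S) : Matrix (ι s) (ι s) ℂ :=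
  ((Fintype.card (ι s) : ℂ) / Fintype.card K) • ∑ y, f y • D.rep s y⁻¹

theorem sum_trace_coeff_mul (f : K → ℂ) (y : K) :
    f y = ∑ s, (D.coeff f s * D.rep s y).trace := by
  have hK : (Fintype.card K : ℂ) ≠ 0 := by exact_mod_cast Fintype.card_ne_zero
  have h1 : ∀ s, (D.coeff f s * D.rep s y).trace = ∑ z, f z / Fintype.card K *
      ((Fintype.card (ι s) : ℂ) * (D.rep s (z⁻¹ * y)).trace) := by
    intro s
    rw [coeff, Matrix.smul_mul, trace_smul, Finset.sum_mul, trace_sum, Finset.smul_sum]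
    refine Finset.sum_congr rfl fun z _ => ?_
    rw [Matrix.smul_mul, trace_smul, ← map_mul, smul_eq_mul, smul_eq_mul]
    ring
  rw [Finset.sum_congr rfl fun s _ => h1 s, Finset.sum_comm]
  simp_rw [← Finset.mul_sum, D.complete, inv_mul_eq_one]
  simp [hK]

/-- The quadratic form of the coefficient at `x` is, up to a nonnegative factor, the sum over `K` of
`f` times the conjugate of a diagonal coefficient, a positive definite product. -/
theorem coeff_posSemidef {f : K → ℂ} (hf : IsPosDefFun f) (s : S) :
    (D.coeff f s).PosSemidef := by
  unfold coeff
  refine PosSemidef.smul ?_ (by positivity)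
  rw [posSemidef_iff_dotProduct_mulVec]
  constructor
  · unfold IsHermitian
    rw [conjTranspose_sum]
    refine Fintype.sum_equiv (Equiv.inv K) _ _ fun y => ?_
    rw [conjTranspose_smul, hf.star_apply, ← rep_inv]
    rfl
  · intro x
    have hE : (vecMulVec x (star x)).PosSemidef := posSemidef_vecMulVec_self_star x
    have h := (hf.mul (IsPosDefFun.trace_mul (D.rep s) (D.rep_inv s) hE).conj).sum_nonneg
    convert h using 1
    rw [sum_mulVec, dotProduct_sum]
    refine Finset.sum_congr rfl fun y _ => ?_
    rw [smul_mulVec, dotProduct_smul, smul_eq_mul]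
    congr 1
    rw [← trace_conjTranspose, conjTranspose_mul, ← rep_inv, conjTranspose_vecMulVec, star_star,
      mul_vecMulVec, trace_vecMulVec, dotProduct_comm]

/-- Taking traces, the block `s` carries total weight `d_s² / |K|`, the Plancherel measure. -/
theorem sum_coeff {r : ℕ} {f : Fin r → K → ℂ} (hsum : ∀ y, ∑ i, f i y = if y = 1 then 1 else 0)
    (s : S) : ∑ i, D.coeff (f i) s = ((Fintype.card (ι s) : ℂ) / Fintype.card K) • 1 := by
  simp only [coeff]
  rw [← Finset.smul_sum, Finset.sum_comm]
  simp_rw [← Finset.sum_smul, hsum]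
  simp

/-- A resolution of the point mass at `1` into positive definite functions is, on average over a
conjugacy class, small in `ℓ¹`. -/
theorem sum_conj_norm_le {r : ℕ} {f : Fin r → K → ℂ} (hf : ∀ i, IsPosDefFun (f i))
    (hsum : ∀ y, ∑ i, f i y = if y = 1 then 1 else 0) (t : K) {a : ℝ} (ha : 0 < a) (k : ℕ) :
    ∑ g, ∑ i, ‖f i (g * t * g⁻¹)‖ ≤ Fintype.card K *
      Real.sqrt (a + (∑ τ, (Fintype.card (ι τ) : ℝ) ^ 2 *
        (‖D.chi τ t‖ / Fintype.card (ι τ) / a) ^ k) *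
          ((∑ s, (Fintype.card (ι s) : ℝ)) / Fintype.card K)) := by
  set X : ℝ := ∑ τ, (Fintype.card (ι τ) : ℝ) ^ 2 *
        (‖D.chi τ t‖ / Fintype.card (ι τ) / a) ^ k with hX
  have hX0 : 0 ≤ X := by positivity
  have hK : (0 : ℝ) < Fintype.card K := by exact_mod_cast Fintype.card_pos
  have htr : ∀ i s, 0 ≤ (D.coeff (f i) s).trace.re := fun i s =>
    (Complex.nonneg_iff.mp (D.coeff_posSemidef (hf i) s).trace_nonneg).1
  have hone : ∀ i s, ∑ g, ‖(D.coeff (f i) s * D.rep s (g * t * g⁻¹)).trace‖ ≤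
      Fintype.card K * (D.coeff (f i) s).trace.re * Real.sqrt (a + X / Fintype.card (ι s)) := by
    intro i s
    have h1 := D.sum_conj_norm_trace_sq_le s (D.coeff_posSemidef (hf i) s) t ha k
    -- Cauchy–Schwarz over the class, to pass from the second moment to the first.
    have h2 : (∑ g, ‖(D.coeff (f i) s * D.rep s (g * t * g⁻¹)).trace‖) ^ 2 ≤
        Fintype.card K * ∑ g, ‖(D.coeff (f i) s * D.rep s (g * t * g⁻¹)).trace‖ ^ 2 :=
      sq_sum_le_card_mul_sum_sq
    refine abs_le_of_sq_le_sq' ?_ (mul_nonneg (mul_nonneg hK.le (htr i s)) (Real.sqrt_nonneg _))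
      |>.2
    refine h2.trans ((mul_le_mul_of_nonneg_left h1 hK.le).trans (le_of_eq ?_))
    rw [mul_pow, Real.sq_sqrt (by positivity)]
    ring
  have htrsum : ∀ s, ∑ i, (D.coeff (f i) s).trace.re =
      (Fintype.card (ι s) : ℝ) ^ 2 / Fintype.card K := by
    intro s
    rw [← Complex.re_sum, ← trace_sum, D.sum_coeff hsum, trace_smul, trace_one, smul_eq_mul]
    have : ((Fintype.card (ι s) : ℂ) / Fintype.card K * Fintype.card (ι s)) =
        (((Fintype.card (ι s) : ℝ) ^ 2 / Fintype.card K : ℝ) : ℂ) := by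
      push_cast
      ring
    rw [this, Complex.ofReal_re]
  calc ∑ g, ∑ i, ‖f i (g * t * g⁻¹)‖
      ≤ ∑ g, ∑ i, ∑ s, ‖(D.coeff (f i) s * D.rep s (g * t * g⁻¹)).trace‖ := by
        refine Finset.sum_le_sum fun g _ => Finset.sum_le_sum fun i _ => ?_
        rw [D.sum_trace_coeff_mul (f i) (g * t * g⁻¹)]
        exact norm_sum_le _ _
    _ = ∑ s, ∑ i, ∑ g, ‖(D.coeff (f i) s * D.rep s (g * t * g⁻¹)).trace‖ := by
        rw [Finset.sum_comm]
        rw [Finset.sum_congr rfl fun i _ => Finset.sum_comm]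
        rw [Finset.sum_comm]
    _ ≤ ∑ s, ∑ i, Fintype.card K * (D.coeff (f i) s).trace.re *
          Real.sqrt (a + X / Fintype.card (ι s)) :=
        Finset.sum_le_sum fun s _ => Finset.sum_le_sum fun i _ => hone i s
    _ = ∑ s, (Fintype.card (ι s) : ℝ) *
          Real.sqrt ((Fintype.card (ι s) : ℝ) ^ 2 * (a + X / Fintype.card (ι s))) := by
        refine Finset.sum_congr rfl fun s _ => ?_
        rw [← Finset.sum_mul, ← Finset.mul_sum, htrsum, Real.sqrt_mul (by positivity),
          Real.sqrt_sq (by positivity), mul_div_cancel₀ _ hK.ne']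
        ring
    -- One factor `d_s` was moved under the root, so that Cauchy–Schwarz over `s` meets `∑ d_s² =
    -- |K|` and leaves `∑ d_s` next to `X`.
    _ ≤ Real.sqrt (∑ s, (Fintype.card (ι s) : ℝ) ^ 2) * Real.sqrt (∑ s,
          Real.sqrt ((Fintype.card (ι s) : ℝ) ^ 2 * (a + X / Fintype.card (ι s))) ^ 2) :=
        Real.sum_mul_le_sqrt_mul_sqrt _ _ _
    _ ≤ Real.sqrt (Fintype.card K) * Real.sqrt (Fintype.card K *
          (a + X * ((∑ s, (Fintype.card (ι s) : ℝ)) / Fintype.card K))) := by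
        rw [D.sum_card_sq]
        gcongr
        have h3 : ∀ s, Real.sqrt ((Fintype.card (ι s) : ℝ) ^ 2 *
            (a + X / Fintype.card (ι s))) ^ 2 =
            (Fintype.card (ι s) : ℝ) ^ 2 * a + X * Fintype.card (ι s) := by
          intro s
          rw [Real.sq_sqrt (by positivity)]
          by_cases hd : (Fintype.card (ι s) : ℝ) = 0
          · simp [hd]
          · field_simp
        rw [Finset.sum_congr rfl fun s _ => h3 s, Finset.sum_add_distrib, ← Finset.sum_mul,
          D.sum_card_sq, ← Finset.mul_sum]
        apply le_of_eq
        field_simp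
    _ = _ := by
        rw [Real.sqrt_mul hK.le, ← mul_assoc, Real.mul_self_sqrt hK.le]

end FourierData

/-! ### The irreducible representations of a finite group -/

section Completeness

variable {G : Type*} [Group G]

theorem exists_irrep_of_isSimpleModule [Finite G]
    (N : Submodule (MonoidAlgebra ℂ G) (MonoidAlgebra ℂ G))
    [IsSimpleModule (MonoidAlgebra ℂ G) N] :
    ∃ (ρ : Irrep G) (e : N ≃ₗ[ℂ] (Fin ρ.dim → ℂ)),
      ∀ (x : MonoidAlgebra ℂ G) (n : N), e (x • n) = ρ.rep.asAlgebraHom x (e n) := by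
  have : Module.Finite ℂ (MonoidAlgebra ℂ G) :=
    Module.Finite.equiv (MonoidAlgebra.coeffLinearEquiv ℂ).symm
  have : Module.Finite ℂ N :=
    Module.Finite.of_injective (N.subtype.restrictScalars ℂ) N.injective_subtype
  let e : N ≃ₗ[ℂ] (Fin (Module.finrank ℂ N) → ℂ) := (Module.finBasis ℂ N).equivFun
  let ρ : Representation ℂ G (Fin (Module.finrank ℂ N) → ℂ) :=
    (e.conjAlgEquiv ℂ : Module.End ℂ N →* _).comp (Representation.ofModule' (k := ℂ) (G := G) N)
  have he : ∀ (x : MonoidAlgebra ℂ G) (n : N), e (x • n) = ρ.asAlgebraHom x (e n) := by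
    intro x n
    induction x using MonoidAlgebra.induction_linear with
    | zero => simp
    | add x y hx hy => simp [add_smul, hx, hy]
    | single g a =>
      have h1 : (MonoidAlgebra.single g a : MonoidAlgebra ℂ G) = a • MonoidAlgebra.single g 1 := by
        simp
      rw [h1, smul_assoc, e.map_smul, map_smul (Representation.asAlgebraHom ρ), Representation.asAlgebraHom_single_one]
      simp [ρ, Representation.ofModule']
  let e' : ρ.asModule ≃ₗ[MonoidAlgebra ℂ G] N :=
    { (ρ.asModuleEquiv.trans e.symm).toAddEquiv with
      map_smul' := fun x v => by
        apply e.injective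
        have := he x (e.symm (ρ.asModuleEquiv v))
        rw [e.apply_symm_apply] at this
        change e (e.symm (ρ.asModuleEquiv (x • v))) = e (x • e.symm (ρ.asModuleEquiv v))
        rw [this, e.apply_symm_apply]
        rfl }
  have : IsSimpleModule (MonoidAlgebra ℂ G) ρ.asModule := IsSimpleModule.congr e'
  exact ⟨⟨_, ρ, ρ.irreducible_iff_isSimpleModule_asModule.mpr this⟩, e, he⟩

/-- By Maschke the group algebra is a sum of simple left ideals. An element that vanishes in every
irreducible representation annihilates each of them, hence annihilates `1`. -/
theorem eq_zero_of_forall_irrep [Fintype G] {f : G → ℂ}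
    (hf : ∀ ρ : Irrep G, ∑ g, f g • ρ.rep g = 0) : f = 0 := by
  let x : MonoidAlgebra ℂ G := ∑ g, MonoidAlgebra.single g (f g)
  have hx : ∀ m : MonoidAlgebra ℂ G, x • m = 0 := by
    intro m
    have : NeZero (Nat.card G : ℂ) := ⟨Nat.cast_ne_zero.mpr Nat.card_pos.ne'⟩
    have hm : m ∈ sSup {N : Submodule (MonoidAlgebra ℂ G) (MonoidAlgebra ℂ G) |
        IsSimpleModule (MonoidAlgebra ℂ G) N} := by
      rw [IsSemisimpleModule.sSup_simples_eq_top]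
      trivial
    rw [sSup_eq_iSup'] at hm
    induction hm using Submodule.iSup_induction' with
    | mem N m hm =>
      have : IsSimpleModule (MonoidAlgebra ℂ G) N.1 := N.2
      obtain ⟨ρ, e, he⟩ := exists_irrep_of_isSimpleModule N.1
      have h1 : ρ.rep.asAlgebraHom x = 0 := by
        rw [map_sum, ← hf ρ]
        simp
      have h2 : x • (⟨m, hm⟩ : N.1) = 0 := by
        apply e.injective
        rw [he, h1]
        simp
      exact congrArg Subtype.val h2
    | zero => simp
    | add m m' _ _ hm hm' => rw [smul_add, hm, hm', add_zero]
  have h1 : x = 0 := by simpa using hx 1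
  have h2 : x = MonoidAlgebra.ofCoeff (Finsupp.equivFunOnFinite.symm f) := by
    classical
    ext g
    simp [x, MonoidAlgebra.coeff_sum, Finsupp.single_apply]
  ext g
  have h3 := congrArg (fun z => MonoidAlgebra.coeff z g) (h2.symm.trans h1)
  simpa using h3

end Completeness

/-! ### Unitary form, Schur's lemma and Schur orthogonality -/

section Unitary

variable {G : Type*} [Group G]

/-- The matrices of an irreducible representation. -/
noncomputable def Irrep.matrix (ρ : Irrep G) : G →* Matrix (Fin ρ.dim) (Fin ρ.dim) ℂ :=
  (LinearMap.toMatrixAlgEquiv' : _ ≃ₐ[ℂ] Matrix (Fin ρ.dim) (Fin ρ.dim) ℂ).toMonoidHom.comp ρ.rep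

theorem Irrep.trace_matrix (ρ : Irrep G) (g : G) : (ρ.matrix g).trace = ρ.rep.character g := by
  rw [Representation.character, LinearMap.trace_eq_matrix_trace ℂ (Pi.basisFun ℂ (Fin ρ.dim)),
    LinearMap.toMatrix_eq_toMatrix']
  rfl

theorem Irrep.dim_ne_zero (ρ : Irrep G) : ρ.dim ≠ 0 := by
  intro h
  have := ρ.irreducible
  obtain ⟨a, b, hab⟩ := exists_pair_ne (Subrepresentation ρ.rep)
  apply hab
  apply Subrepresentation.toSubmodule_injective
  have : IsEmpty (Fin ρ.dim) := by rw [h]; infer_instance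
  exact Subsingleton.elim _ _

/-- Schur's lemma. -/
theorem Irrep.exists_eq_smul_one_of_commute (ρ : Irrep G) {T : Matrix (Fin ρ.dim) (Fin ρ.dim) ℂ}
    (hT : ∀ g, T * ρ.matrix g = ρ.matrix g * T) : ∃ c : ℂ, T = c • 1 := by
  have := ρ.irreducible
  let f : Representation.IntertwiningMap ρ.rep ρ.rep :=
    ⟨LinearMap.toMatrixAlgEquiv'.symm T, fun g => by
      apply LinearMap.toMatrixAlgEquiv'.injective
      have := hT g
      change LinearMap.toMatrixAlgEquiv' (LinearMap.toMatrixAlgEquiv'.symm T * ρ.rep g) =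
        LinearMap.toMatrixAlgEquiv' (ρ.rep g * LinearMap.toMatrixAlgEquiv'.symm T)
      rw [map_mul, map_mul, AlgEquiv.apply_symm_apply]
      exact this⟩
  obtain ⟨c, hc⟩ :=
    (Representation.IsIrreducible.algebraMap_intertwiningMap_bijective_of_isAlgClosed (ρ := ρ.rep)).2 f
  refine ⟨c, ?_⟩
  have h1 : LinearMap.toMatrixAlgEquiv'.symm T = c • (1 : Module.End ℂ (Fin ρ.dim → ℂ)) :=
    (congrArg Representation.IntertwiningMap.toLinearMap hc).symm
  rw [AlgEquiv.symm_apply_eq, map_smul, map_one] at h1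
  exact h1

theorem Irrep.exists_unitary [Fintype G] (ρ : Irrep G) :
    ∃ U : G →* Matrix (Fin ρ.dim) (Fin ρ.dim) ℂ, (∀ g, U g⁻¹ = (U g)ᴴ) ∧
      (∀ g, (U g).trace = ρ.rep.character g) ∧
      ∀ T, (∀ g, T * U g = U g * T) → ∃ c : ℂ, T = c • 1 := by
  classical
  let P : Matrix (Fin ρ.dim) (Fin ρ.dim) ℂ := ∑ g, (ρ.matrix g)ᴴ * ρ.matrix g
  -- The term at the identity is `1`, so the averaged form is definite. Conjugating by a square-root
  -- factor of it makes the representation unitary.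
  have hP : P.PosDef := by
    have h1 : P = 1 + ∑ g ∈ univ.erase 1, (ρ.matrix g)ᴴ * ρ.matrix g := by
      rw [show P = _ from (Finset.add_sum_erase univ _ (mem_univ (1 : G))).symm]
      simp
    rw [h1]
    exact PosDef.one.add_posSemidef
      (posSemidef_sum _ fun g _ => posSemidef_conjTranspose_mul_self _)
  have hPinv : ∀ g, (ρ.matrix g)ᴴ * P * ρ.matrix g = P := by
    intro g
    simp only [P, Finset.mul_sum, Finset.sum_mul]
    refine Fintype.sum_equiv (Equiv.mulRight g) _ _ fun y => ?_
    simp [Matrix.mul_assoc]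
  obtain ⟨A, hA⟩ := hP.posSemidef.exists_eq_conjTranspose_mul_self
  have hAu : IsUnit A := by
    rw [isUnit_iff_isUnit_det]
    have h1 := (isUnit_iff_isUnit_det P).mp hP.isUnit
    rw [hA, det_mul] at h1
    exact isUnit_of_mul_isUnit_right h1
  have hAd := (isUnit_iff_isUnit_det A).mp hAu
  let U : G →* Matrix (Fin ρ.dim) (Fin ρ.dim) ℂ :=
    { toFun := fun g => A * ρ.matrix g * A⁻¹
      map_one' := by simp [mul_nonsing_inv A hAd]
      map_mul' := fun g h => by
        have : A⁻¹ * A = 1 := nonsing_inv_mul A hAd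
        calc A * ρ.matrix (g * h) * A⁻¹ = A * ρ.matrix g * 1 * ρ.matrix h * A⁻¹ := by
              rw [map_mul, mul_one]; simp only [Matrix.mul_assoc]
          _ = _ := by rw [← this]; simp only [Matrix.mul_assoc] }
  have hU : ∀ g, U g = A * ρ.matrix g * A⁻¹ := fun g => rfl
  refine ⟨U, fun g => ?_, fun g => ?_, fun T hT => ?_⟩
  · have h1 : (U g)ᴴ * U g = 1 := by
      calc (U g)ᴴ * U g = (A⁻¹)ᴴ * ((ρ.matrix g)ᴴ * (Aᴴ * A) * ρ.matrix g) * A⁻¹ := by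
            rw [hU]; simp only [conjTranspose_mul, Matrix.mul_assoc]
        _ = (A * A⁻¹)ᴴ * (A * A⁻¹) := by
            rw [← hA, hPinv, hA]; simp only [conjTranspose_mul, Matrix.mul_assoc]
        _ = 1 := by rw [mul_nonsing_inv A hAd]; simp
    have h2 : U g * U g⁻¹ = 1 := by rw [← map_mul, mul_inv_cancel, map_one]
    exact (left_inv_eq_right_inv h1 h2).symm
  · rw [hU, Matrix.mul_assoc, trace_mul_comm, Matrix.mul_assoc, nonsing_inv_mul A hAd, mul_one,
      ρ.trace_matrix]
  · obtain ⟨c, hc⟩ := ρ.exists_eq_smul_one_of_commute (T := A⁻¹ * T * A) fun g => by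
      have h1 := hT g
      rw [hU] at h1
      calc A⁻¹ * T * A * ρ.matrix g = A⁻¹ * (T * (A * ρ.matrix g * A⁻¹)) * A := by
            simp only [Matrix.mul_assoc, nonsing_inv_mul A hAd, mul_one]
        _ = (A⁻¹ * A) * ρ.matrix g * (A⁻¹ * T * A) := by
            rw [h1]; simp only [Matrix.mul_assoc]
        _ = _ := by rw [nonsing_inv_mul A hAd, one_mul]
    refine ⟨c, ?_⟩
    calc T = (A * A⁻¹) * T * (A * A⁻¹) := by rw [mul_nonsing_inv A hAd, one_mul, mul_one]
      _ = A * (A⁻¹ * T * A) * A⁻¹ := by simp only [Matrix.mul_assoc]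
      _ = _ := by
        rw [hc, Matrix.mul_smul, mul_one, Matrix.smul_mul, mul_nonsing_inv A hAd]

theorem schur_of_commutant {d : ℕ} [Fintype G] (U : G →* Matrix (Fin d) (Fin d) ℂ)
    (hU : ∀ g, U g⁻¹ = (U g)ᴴ) (hc : ∀ T, (∀ g, T * U g = U g * T) → ∃ c : ℂ, T = c • 1)
    (a b a' b' : Fin d) : ∑ y, U y a b * star (U y a' b') =
      if a = a' ∧ b = b' then (Fintype.card G : ℂ) / d else 0 := by
  have hd : (d : ℂ) ≠ 0 := by
    have := a.pos
    exact_mod_cast this.ne'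
  have hUinv : ∀ g, (U g)ᴴ * U g = 1 := fun g => by
    rw [← hU, ← map_mul, inv_mul_cancel, map_one]
  -- The averaged matrix unit commutes with the representation, so it is a scalar, fixed by its
  -- trace.
  obtain ⟨c, hT⟩ := hc (∑ g, U g * single b b' (1 : ℂ) * (U g)ᴴ) fun h => by
    rw [Finset.sum_mul, Finset.mul_sum]
    refine Fintype.sum_equiv (Equiv.mulLeft h⁻¹) _ _ fun y => ?_
    have h1 : (U (h⁻¹ * y))ᴴ = (U y)ᴴ * U h := by
      rw [← hU, _root_.mul_inv_rev, inv_inv, map_mul, hU]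
    have h2 : U h * U (h⁻¹ * y) = U y := by rw [← map_mul, mul_inv_cancel_left]
    simp only [Equiv.coe_mulLeft]
    rw [h1, ← h2]
    simp only [Matrix.mul_assoc]
  have htr : (Fintype.card G : ℂ) * (if b = b' then 1 else 0) = c * d := by
    have h1 := congrArg trace hT
    rw [trace_sum, trace_smul, trace_one, Fintype.card_fin, smul_eq_mul] at h1
    rw [← h1]
    have h2 : ∀ g, (U g * single b b' (1 : ℂ) * (U g)ᴴ).trace = if b = b' then 1 else 0 := by
      intro g
      rw [trace_mul_comm, ← Matrix.mul_assoc, hUinv, one_mul]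
      by_cases h : b = b'
      · subst h; simp
      · simp [h]
    simp [h2]
  have hcd : c = if b = b' then (Fintype.card G : ℂ) / d else 0 := by
    rw [← div_eq_iff hd] at htr
    by_cases h : b = b'
    · simp [h] at htr ⊢; rw [← htr]
    · simp [h] at htr ⊢; exact htr.symm
  have h3 := congrFun (congrFun hT a) a'
  rw [Matrix.sum_apply] at h3
  have h4 : ∀ g, (U g * single b b' (1 : ℂ) * (U g)ᴴ) a a' = U g a b * star (U g a' b') := by
    intro g
    rw [mul_apply, Finset.sum_eq_single b']
    · simp [mul_apply, single_apply]
    · intro e _ he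
      simp [mul_apply, he.symm]
    · simp
  rw [← Finset.sum_congr rfl fun g _ => h4 g, h3, Matrix.smul_apply, one_apply, hcd]
  by_cases h : a = a' <;> by_cases h' : b = b' <;> simp [h, h']

end Unitary

/-! ### Decomposition of the regular character -/

section Data

variable {G : Type*} [Group G]

theorem IrrepClass.dim_out (σ : IrrepClass G) : σ.out.dim = σ.dim := by
  conv_rhs => rw [← Quotient.out_eq σ]
  rfl

theorem IrrepClass.character_out (σ : IrrepClass G) : σ.out.rep.character = σ.character := by
  conv_rhs => rw [← Quotient.out_eq σ]
  rfl

/-- The difference of the two sides, with `y` inverted, is killed by every irreducible `ρ`: the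
class function `χ_σ(y⁻¹)` acts on `ρ` as the scalar `|G| / d_ρ` if `σ` is the class of `ρ` and as
`0` otherwise. -/
theorem IrrepClass.sum_dim_mul_character [Fintype G] [DecidableEq G] (y : G) :
    ∑ σ : IrrepClass G, (σ.dim : ℂ) * σ.character y =
      if y = 1 then (Fintype.card G : ℂ) else 0 := by
  have hcard : (Nat.card G : ℂ) ≠ 0 := Nat.cast_ne_zero.mpr Nat.card_pos.ne'
  have key : (fun y : G => ∑ σ : IrrepClass G, (σ.dim : ℂ) * σ.character y⁻¹ -
      if y = 1 then (Fintype.card G : ℂ) else 0) = 0 := by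
    apply eq_zero_of_forall_irrep
    intro ρ
    have hd : (ρ.dim : ℂ) ≠ 0 := Nat.cast_ne_zero.mpr ρ.dim_ne_zero
    classical
    have hmat : ∑ y : G, (∑ σ : IrrepClass G, (σ.dim : ℂ) * σ.character y⁻¹ -
        if y = 1 then (Fintype.card G : ℂ) else 0) • ρ.matrix y = 0 := by
      have h1 : ∀ σ : IrrepClass G, ∑ y : G, σ.character y⁻¹ • ρ.matrix y =
          (if Quotient.mk _ ρ = σ then (Nat.card G : ℂ) / ρ.dim else 0) • 1 := by
        intro σ
        obtain ⟨c, hc⟩ := ρ.exists_eq_smul_one_of_commute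
          (T := ∑ y : G, σ.character y⁻¹ • ρ.matrix y) fun g => by
            rw [Finset.sum_mul, Finset.mul_sum]
            refine Fintype.sum_equiv (MulAut.conj g⁻¹).toEquiv _ _ fun y => ?_
            have h2 : σ.character (MulAut.conj g⁻¹ y)⁻¹ = σ.character y⁻¹ := by
              rw [← map_inv, MulAut.conj_apply, ← σ.character_out, Representation.char_conj]
            change _ = ρ.matrix g * σ.character (MulAut.conj g⁻¹ y)⁻¹ •
              ρ.matrix (MulAut.conj g⁻¹ y)
            rw [h2, Matrix.smul_mul, Matrix.mul_smul, ← map_mul, ← map_mul, MulAut.conj_apply]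
            congr 2
            group
        rw [hc]
        congr 1
        have h3 := congrArg trace hc
        rw [trace_smul, trace_one, Fintype.card_fin, trace_sum] at h3
        have h4 := IrrepClass.orthonormal (Quotient.mk (irrepSetoid G) ρ) σ
        have h5 : ∑ y : G, (σ.character y⁻¹ • ρ.matrix y).trace =
            ∑ y, IrrepClass.character (Quotient.mk (irrepSetoid G) ρ) y *
              σ.character y⁻¹ := by
          refine Finset.sum_congr rfl fun y _ => ?_
          rw [trace_smul, ρ.trace_matrix, smul_eq_mul, mul_comm]
          rfl
        rw [h5] at h3
        rw [h3, smul_eq_mul] at h4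
        by_cases h : (Quotient.mk (irrepSetoid G) ρ : IrrepClass G) = σ
        · rw [if_pos h] at h4 ⊢
          field_simp at h4 ⊢
          exact h4
        · rw [if_neg h] at h4 ⊢
          simpa [hcard, hd] using h4
      simp only [sub_smul, Finset.sum_sub_distrib, Finset.sum_smul]
      rw [Finset.sum_comm]
      simp only [mul_smul, ← Finset.smul_sum, h1]
      simp only [ite_smul, zero_smul, smul_ite, smul_zero, Finset.sum_ite_eq, Finset.sum_ite_eq',
        Finset.mem_univ, if_true, map_one]
      rw [smul_smul, ← sub_smul]
      have h6 : (IrrepClass.dim (Quotient.mk (irrepSetoid G) ρ) : ℂ) = ρ.dim := rfl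
      rw [h6, mul_div_cancel₀ _ hd, Nat.card_eq_fintype_card, sub_self, zero_smul]
    apply LinearMap.toMatrixAlgEquiv'.injective
    rw [map_zero, ← hmat, map_sum]
    simp only [map_smul]
    rfl
  have h := congrFun key y⁻¹
  simpa [sub_eq_zero] using h

/-- The irreducible representations of a finite group, in unitary form. -/
theorem exists_fourierData [Fintype G] [DecidableEq G] :
    ∃ D : FourierData G (fun σ : IrrepClass G => Fin σ.dim),
      ∀ σ y, D.chi σ y = σ.character y := by
  have h : ∀ σ : IrrepClass G, ∃ U : G →* Matrix (Fin σ.dim) (Fin σ.dim) ℂ,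
      (∀ g, U g⁻¹ = (U g)ᴴ) ∧ (∀ g, (U g).trace = σ.character g) ∧
      ∀ T, (∀ g, T * U g = U g * T) → ∃ c : ℂ, T = c • 1 := by
    intro σ
    rw [← σ.dim_out, ← σ.character_out]
    exact σ.out.exists_unitary
  choose U h1 h2 h3 using h
  refine ⟨⟨U, h1, fun σ => ?_, fun y => ?_⟩, fun σ y => h2 σ y⟩
  · rw [Fintype.card_fin]
    exact schur_of_commutant (U σ) (h1 σ) (h3 σ)
  · simp only [Fintype.card_fin, h2]
    exact IrrepClass.sum_dim_mul_character y

end Data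

/-! ### Powers of a group -/

theorem sum_pi_prod_eq {R : Type*} [CommSemiring R] {I : Type*} [Fintype I] [DecidableEq I]
    {κ : I → Type*} [∀ i, Fintype (κ i)] (f : ∀ i, κ i → R) :
    ∑ x : ∀ i, κ i, ∏ i, f i (x i) = ∏ i, ∑ j, f i j := by
  rw [Finset.prod_univ_sum, Fintype.piFinset_univ]

namespace FourierData

variable {G : Type*} [Group G] [Fintype G] [DecidableEq G] {S : Type*} [Fintype S]
  {ι : S → Type*} [∀ s, Fintype (ι s)] [∀ s, DecidableEq (ι s)] (D : FourierData G ι)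

/-- Tensor products of the representations in `D` give Fourier data for the power `G ^ n`. -/
noncomputable def pi (n : ℕ) :
    FourierData (Fin n → G) (fun s : Fin n → S => ∀ i, ι (s i)) where
  rep s :=
    { toFun := fun y => Matrix.of fun a b => ∏ i, D.rep (s i) (y i) (a i) (b i)
      map_one' := by
        ext a b
        simp only [of_apply, Pi.one_apply, map_one, one_apply]
        rw [Fintype.prod_ite_zero]
        simp [funext_iff]
      map_mul' := fun y z => by
        ext a b
        simp only [of_apply, Pi.mul_apply, map_mul, mul_apply, ← Finset.prod_mul_distrib]
        rw [sum_pi_prod_eq fun i c => D.rep (s i) (y i) (a i) c * D.rep (s i) (z i) c (b i)] }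
  rep_inv s y := by
    ext a b
    simp [D.rep_inv]
  schur s a b a' b' := by
    simp only [MonoidHom.coe_mk, OneHom.coe_mk, of_apply, star_prod, ← Finset.prod_mul_distrib]
    rw [sum_pi_prod_eq fun i y => D.rep (s i) y (a i) (b i) * star (D.rep (s i) y (a' i) (b' i))]
    simp only [D.schur]
    rw [Fintype.prod_ite_zero]
    simp [funext_iff, forall_and, Fintype.card_pi, Finset.prod_div_distrib]
  complete y := by
    have h : ∀ s : Fin n → S, (Fintype.card (∀ i, ι (s i)) : ℂ) *
        (Matrix.of fun a b : ∀ i, ι (s i) => ∏ i, D.rep (s i) (y i) (a i) (b i)).trace =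
        ∏ i, ((Fintype.card (ι (s i)) : ℂ) * (D.rep (s i) (y i)).trace) := by
      intro s
      simp only [trace, diag_apply, of_apply]
      rw [sum_pi_prod_eq fun i c => D.rep (s i) (y i) c c, Fintype.card_pi, Nat.cast_prod,
        Finset.prod_mul_distrib]
    simp only [MonoidHom.coe_mk, OneHom.coe_mk, h]
    rw [sum_pi_prod_eq fun i c => (Fintype.card (ι c) : ℂ) * (D.rep c (y i)).trace]
    simp only [D.complete]
    rw [Fintype.prod_ite_zero]
    simp [funext_iff]

theorem chi_pi (n : ℕ) (s : Fin n → S) (y : Fin n → G) :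
    (D.pi n).chi s y = ∏ i, D.chi (s i) (y i) := by
  simp only [chi, pi, trace, diag_apply, of_apply, MonoidHom.coe_mk, OneHom.coe_mk]
  rw [sum_pi_prod_eq fun i c => D.rep (s i) (y i) c c]

/-- The resolution bound in a power of `G`, over the conjugacy class of a constant tuple. -/
theorem sum_conj_norm_le_pi {n r : ℕ} {f : Fin r → (Fin n → G) → ℂ}
    (hf : ∀ i, IsPosDefFun (f i)) (hsum : ∀ y, ∑ i, f i y = if y = 1 then 1 else 0) (h : G)
    {a : ℝ} (ha : 0 < a) (k : ℕ) :
    ∑ g, ∑ i, ‖f i (g * (fun _ : Fin n => h) * g⁻¹)‖ ≤ Fintype.card (Fin n → G) *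
      Real.sqrt (a ^ n + ((∑ τ, (Fintype.card (ι τ) : ℝ) ^ 2 *
        (‖D.chi τ h‖ / Fintype.card (ι τ) / a) ^ k) *
          ((∑ s, (Fintype.card (ι s) : ℝ)) / Fintype.card G)) ^ n) := by
  have h1 := (D.pi n).sum_conj_norm_le hf hsum (fun _ => h) (pow_pos ha n) k
  refine h1.trans (le_of_eq ?_)
  congr 3
  rw [mul_pow, div_pow]
  congr 1
  · have h2 : ∀ s : Fin n → S, (Fintype.card (∀ i, ι (s i)) : ℝ) ^ 2 *
        (‖(D.pi n).chi s (fun _ => h)‖ / Fintype.card (∀ i, ι (s i)) / a ^ n) ^ k =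
        ∏ i, ((Fintype.card (ι (s i)) : ℝ) ^ 2 *
          (‖D.chi (s i) h‖ / Fintype.card (ι (s i)) / a) ^ k) := by
      intro s
      rw [chi_pi, norm_prod, Fintype.card_pi, Nat.cast_prod, Finset.prod_mul_distrib,
        Finset.prod_pow, Finset.prod_pow, Finset.prod_div_distrib, Finset.prod_div_distrib]
      simp
    simp only [h2]
    rw [sum_pi_prod_eq fun _ τ => (Fintype.card (ι τ) : ℝ) ^ 2 *
      (‖D.chi τ h‖ / Fintype.card (ι τ) / a) ^ k]
    simp
  · congr 1
    · simp only [Fintype.card_pi, Nat.cast_prod]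
      rw [sum_pi_prod_eq fun _ τ => (Fintype.card (ι τ) : ℝ)]
      simp
    · simp

end FourierData

open Filter in
/-- Under the dimension hypothesis, the average over the conjugacy class decays exponentially. -/
theorem exists_exponential_bound {G : Type*} [Group G] [Fintype G] [DecidableEq G] (h : G)
    (hG : Real.sqrt (Fintype.card G) > Real.sqrt (Fintype.card (IrrepClass G)) *
        ∑ σ ∈ extremalIrreps h, (σ.dim : ℝ) ^ 2) :
    ∃ β : ℝ, 0 < β ∧ β < 1 ∧ ∀ (n r : ℕ) (f : Fin r → (Fin n → G) → ℂ),
      (∀ i, IsPosDefFun (f i)) → (∀ y, ∑ i, f i y = if y = 1 then 1 else 0) →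
      ∑ g, ∑ i, ‖f i (g * (fun _ : Fin n => h) * g⁻¹)‖ ≤
        Fintype.card (Fin n → G) * (2 * β ^ n) := by
  classical
  obtain ⟨D, hD⟩ := exists_fourierData (G := G)
  have hcard : (0 : ℝ) < Fintype.card G := by exact_mod_cast Fintype.card_pos
  have hd : ∀ σ : IrrepClass G, (0 : ℝ) < σ.dim := fun σ => by
    rw [← σ.dim_out]
    exact_mod_cast Nat.pos_of_ne_zero σ.out.dim_ne_zero
  set L : ℝ := ∑ σ ∈ extremalIrreps h, (σ.dim : ℝ) ^ 2 with hL
  set κ : ℝ := (∑ σ : IrrepClass G, (σ.dim : ℝ)) / Fintype.card G with hκ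
  have hκ0 : 0 ≤ κ := by positivity
  -- The only use of the hypothesis: Cauchy–Schwarz gives `∑ d_σ ≤ (|Ĝ| |G|)^{1/2}`.
  have hLκ : L * κ < 1 := by
    have h1 : ∑ σ : IrrepClass G, (σ.dim : ℝ) ≤
        Real.sqrt (Fintype.card (IrrepClass G)) * Real.sqrt (Fintype.card G) := by
      have h2 := D.sum_card_sq
      simp only [Fintype.card_fin] at h2
      rw [← h2, ← Real.sqrt_mul (by positivity)]
      exact Real.le_sqrt_of_sq_le sq_sum_le_card_mul_sum_sq
    have hL0 : 0 ≤ L := by positivity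
    have hs := Real.sqrt_pos.mpr hcard
    have h3 : L * κ * Fintype.card G < Fintype.card G := by
      calc L * κ * Fintype.card G = L * ∑ σ : IrrepClass G, (σ.dim : ℝ) := by
            rw [hκ]; field_simp
        _ ≤ L * (Real.sqrt (Fintype.card (IrrepClass G)) * Real.sqrt (Fintype.card G)) := by
            gcongr
        _ = (Real.sqrt (Fintype.card (IrrepClass G)) * L) * Real.sqrt (Fintype.card G) := by ring
        _ < Real.sqrt (Fintype.card G) * Real.sqrt (Fintype.card G) := by gcongr
        _ = _ := Real.mul_self_sqrt hcard.le
    nlinarith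
  have hlim : Tendsto (fun k : ℕ => (∑ σ : IrrepClass G, (σ.dim : ℝ) ^ 2 *
      (‖σ.character h‖ / σ.dim) ^ k) * κ) atTop (nhds (L * κ)) := by
    have h1 : L = ∑ σ : IrrepClass G, (σ.dim : ℝ) ^ 2 *
        (if σ ∈ extremalIrreps h then 1 else 0) := by
      rw [hL]
      simp
    rw [h1]
    refine (tendsto_finsetSum _ fun σ _ => Tendsto.const_mul _ ?_).mul_const _
    have hle : ‖σ.character h‖ / σ.dim ≤ 1 := by
      rw [div_le_one (hd σ), ← hD]
      simpa using D.norm_chi_le σ h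
    by_cases hσ : σ ∈ extremalIrreps h
    · rw [if_pos hσ]
      have h2 : ‖σ.character h‖ / σ.dim = 1 := by
        rw [extremalIrreps, Finset.mem_filter] at hσ
        rw [hσ.2, div_self (hd σ).ne']
      refine tendsto_const_nhds.congr fun k => ?_
      rw [h2, one_pow]
    · rw [if_neg hσ]
      refine tendsto_pow_atTop_nhds_zero_of_lt_one (by positivity) (lt_of_le_of_ne hle ?_)
      intro h3
      apply hσ
      rw [extremalIrreps, Finset.mem_filter]
      exact ⟨mem_univ _, by rwa [div_eq_one_iff_eq (hd σ).ne'] at h3⟩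
  -- As `k` grows only `Λ` survives. Fix `k` at threshold `1` first; continuity then allows a
  -- threshold `a < 1`.
  obtain ⟨k, hk⟩ := (hlim.eventually (gt_mem_nhds hLκ)).exists
  have hcont : ContinuousAt (fun a : ℝ => (∑ σ : IrrepClass G, (σ.dim : ℝ) ^ 2 *
      (‖σ.character h‖ / σ.dim / a) ^ k) * κ) 1 := by
    have : (1 : ℝ) ≠ 0 := one_ne_zero
    fun_prop (disch := assumption)
  have hev : ∀ᶠ a : ℝ in nhdsWithin 1 (Set.Iio 1), (∑ σ : IrrepClass G, (σ.dim : ℝ) ^ 2 *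
      (‖σ.character h‖ / σ.dim / a) ^ k) * κ < 1 :=
    (hcont.tendsto.mono_left nhdsWithin_le_nhds).eventually (gt_mem_nhds (by simpa using hk))
  have hev2 : ∀ᶠ a : ℝ in nhdsWithin 1 (Set.Iio 1), 0 < a :=
    Filter.Eventually.filter_mono nhdsWithin_le_nhds (lt_mem_nhds one_pos)
  have hev3 : ∀ᶠ a : ℝ in nhdsWithin 1 (Set.Iio 1), a < 1 := eventually_mem_nhdsWithin
  obtain ⟨a, ha1, ha0, halt⟩ := (hev.and (hev2.and hev3)).exists
  set X : ℝ := (∑ σ : IrrepClass G, (σ.dim : ℝ) ^ 2 *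
      (‖σ.character h‖ / σ.dim / a) ^ k) * κ with hX
  have hX0 : 0 ≤ X := by positivity
  -- Both `a ^ n` and `X ^ n` are at most `max a X ^ n`, and the root of their sum is at most `2 * β
  -- ^ n`.
  refine ⟨Real.sqrt (max a X), Real.sqrt_pos.mpr (lt_max_of_lt_left ha0), ?_, ?_⟩
  · rw [Real.sqrt_lt' one_pos, one_pow]
    exact max_lt halt ha1
  intro n r f hf hsum
  have h1 := D.sum_conj_norm_le_pi hf hsum h ha0 k
  simp only [Fintype.card_fin, hD] at h1
  refine h1.trans (mul_le_mul_of_nonneg_left ?_ (by positivity))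
  have hm : 0 ≤ max a X := le_max_of_le_left ha0.le
  have h5 : (2 * Real.sqrt (max a X) ^ n) ^ 2 = 4 * max a X ^ n := by
    rw [mul_pow, ← pow_mul, mul_comm n 2, pow_mul, Real.sq_sqrt hm]
    norm_num
  rw [Real.sqrt_le_left (by positivity), h5]
  have h2 : a ^ n ≤ max a X ^ n := by gcongr; exact le_max_left _ _
  have h3 : X ^ n ≤ max a X ^ n := by gcongr; exact le_max_right _ _
  have h4 : 0 ≤ max a X ^ n := by positivity
  change a ^ n + X ^ n ≤ _
  linarith

/-! ### Coset states -/

section CosetState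

variable {K : Type*} [Group K] [Fintype K]

open Classical in
theorem cosetState_apply (H : Subgroup K) (x y : K) :
    cosetState H x y = (Fintype.card K : ℂ)⁻¹ * if x⁻¹ * y ∈ H then 1 else 0 := by
  have hH : (0 : ℝ) < Nat.card H := by exact_mod_cast Nat.card_pos
  have hsq : (((Real.sqrt (Nat.card H))⁻¹ : ℝ) : ℂ) * (((Real.sqrt (Nat.card H))⁻¹ : ℝ) : ℂ) =
      (Nat.card H : ℂ)⁻¹ := by
    rw [← Complex.ofReal_mul, ← mul_inv, Real.mul_self_sqrt hH.le]
    push_cast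
    rfl
  rw [cosetState, Matrix.smul_apply, Matrix.sum_apply, smul_eq_mul]
  congr 1
  have h1 : ∀ g : K, vecMulVec (cosetVector H g) (star (cosetVector H g)) x y =
      if x⁻¹ * y ∈ H then (if g⁻¹ * x ∈ H then (Nat.card H : ℂ)⁻¹ else 0) else 0 := by
    intro g
    rw [vecMulVec_apply, Pi.star_apply, cosetVector, cosetVector]
    by_cases hx : g⁻¹ * x ∈ H
    · have h2 : x⁻¹ * y ∈ H ↔ g⁻¹ * y ∈ H := by
        rw [← Subgroup.mul_mem_cancel_left H hx]
        simp [mul_assoc]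
      by_cases hy : g⁻¹ * y ∈ H
      · rw [if_pos hx, if_pos hy, if_pos (h2.mpr hy), if_pos hx, Complex.star_def,
          Complex.conj_ofReal, hsq]
      · rw [if_neg hy, if_neg (fun h => hy (h2.mp h)), star_zero, mul_zero]
    · simp [hx]
  rw [Finset.sum_congr rfl fun g _ => h1 g]
  split_ifs
  · have h3 : ∑ g : K, (if g⁻¹ * x ∈ H then (Nat.card H : ℂ)⁻¹ else 0) =
        ∑ z : K, (if z ∈ H then (Nat.card H : ℂ)⁻¹ else 0) :=
      Fintype.sum_equiv ((Equiv.inv K).trans (Equiv.mulRight x)) _ _ fun g => rfl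
    rw [h3, ← Finset.sum_filter, Finset.sum_const, ← Fintype.card_subtype,
      ← Nat.card_eq_fintype_card, nsmul_eq_mul]
    exact mul_inv_cancel₀ (by exact_mod_cast hH.ne')
  · simp

theorem cosetState_posSemidef (H : Subgroup K) : (cosetState H).PosSemidef :=
  (posSemidef_sum _ fun _ _ => posSemidef_vecMulVec_self_star _).smul (by positivity)

theorem trace_cosetState (H : Subgroup K) : (cosetState H).trace = 1 := by
  have hK : (Fintype.card K : ℂ) ≠ 0 := by exact_mod_cast Fintype.card_ne_zero
  simp [trace, cosetState_apply, H.one_mem, hK]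

end CosetState

theorem tensorPower_posSemidef {X : Type*} [Fintype X] [DecidableEq X] (m : ℕ) {A : Matrix X X ℂ}
    (hA : A.PosSemidef) : (tensorPower m A).PosSemidef := by
  obtain ⟨B, rfl⟩ := hA.exists_eq_conjTranspose_mul_self
  have h : tensorPower m (Bᴴ * B) = (tensorPower m B)ᴴ * tensorPower m B := by
    ext x y
    simp only [tensorPower, of_apply, mul_apply, conjTranspose_apply, star_prod,
      ← Finset.prod_mul_distrib]
    rw [sum_pi_prod_eq fun i k => star (B k (x i)) * B k (y i)]
  rw [h]
  exact posSemidef_conjTranspose_mul_self _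

theorem trace_tensorPower {X : Type*} [Fintype X] [DecidableEq X] (m : ℕ) (A : Matrix X X ℂ) :
    (tensorPower m A).trace = A.trace ^ m := by
  simp only [tensorPower, trace, diag_apply, of_apply]
  rw [sum_pi_prod_eq fun _ k => A k k]
  simp

namespace POVM

variable {X : Type*} [Fintype X] [DecidableEq X] {r : ℕ} (M : POVM X r)

theorem prob_nonneg {s : Matrix X X ℂ} (hs : s.PosSemidef) (i : Fin r) : 0 ≤ M.prob s i := by
  obtain ⟨A, hA⟩ := (M.posSemidef i).exists_eq_conjTranspose_mul_self
  rw [prob, hA, ← Matrix.mul_assoc, trace_mul_comm, ← Matrix.mul_assoc]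
  exact (Complex.nonneg_iff.mp (hs.mul_mul_conjTranspose_same A).trace_nonneg).1

theorem sum_prob (s : Matrix X X ℂ) : ∑ i, M.prob s i = s.trace.re := by
  simp only [prob]
  rw [← Complex.re_sum, ← trace_sum, ← Finset.mul_sum, M.sum_eq_one, mul_one]

end POVM

/-! ### Right translations -/

section Translation

/-- The right regular representation, by permutation matrices. -/
def rightTranslation (W : Type*) [Group W] [Fintype W] [DecidableEq W] : W →* Matrix W W ℂ where
  toFun w := Matrix.of fun x x' => if x' = x * w then 1 else 0
  map_one' := by
    ext x x'
    simp [one_apply, eq_comm]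
  map_mul' w w' := by
    ext x x'
    rw [mul_apply, Finset.sum_eq_single (x * w)]
    · simp [mul_assoc]
    · intro z _ hz
      simp [hz]
    · simp

variable {W : Type*} [Group W] [Fintype W] [DecidableEq W]

theorem rightTranslation_apply (w x x' : W) :
    rightTranslation W w x x' = if x' = x * w then 1 else 0 := rfl

theorem rightTranslation_inv (w : W) : rightTranslation W w⁻¹ = (rightTranslation W w)ᴴ := by
  ext x x'
  simp [rightTranslation_apply, eq_mul_inv_iff_mul_eq, eq_comm, apply_ite]

theorem trace_rightTranslation (w : W) :
    (rightTranslation W w).trace = if w = 1 then (Fintype.card W : ℂ) else 0 := by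
  by_cases hw : w = 1 <;> simp [trace, rightTranslation_apply, hw]

end Translation

/-! ### Expansion of several coset states over sets of registers -/

section Registers

variable {K : Type*} [Group K] {m : ℕ}

/-- The embedding of a group into its `m`-th power, diagonally in the coordinates of `S`. -/
def diagEmbed (K : Type*) [Group K] (S : Finset (Fin m)) : K →* (Fin m → K) where
  toFun y j := if j ∈ S then y else 1
  map_one' := by ext; simp
  map_mul' y z := by
    ext j
    by_cases h : j ∈ S <;> simp [h]

theorem diagEmbed_eq_one_iff {S : Finset (Fin m)} (hS : S.Nonempty) (y : K) :
    diagEmbed K S y = 1 ↔ y = 1 := by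
  constructor
  · intro h
    obtain ⟨j, hj⟩ := hS
    simpa [diagEmbed, hj] using congrFun h j
  · rintro rfl
    exact map_one _

theorem map_conj_zpowers (g t : K) :
    (Subgroup.zpowers t).map (MulAut.conj g).toMonoidHom = Subgroup.zpowers (g * t * g⁻¹) := by
  rw [MonoidHom.map_zpowers]
  rfl

variable [Fintype K] [DecidableEq K]

/-- The identity translation is written as `diagEmbed K ∅ 1` to match the term `S = ∅` of the next
expansion. -/
theorem tensorPower_cosetState_bot :
    tensorPower m (cosetState (⊥ : Subgroup K)) =
      ((Fintype.card K : ℂ) ^ m)⁻¹ • rightTranslation (Fin m → K) (diagEmbed K ∅ 1) := by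
  ext x y
  simp only [tensorPower, of_apply, cosetState_apply, Finset.prod_mul_distrib, Matrix.smul_apply,
    Subgroup.mem_bot, map_one]
  rw [Fintype.prod_ite_zero]
  simp [one_apply, funext_iff, inv_mul_eq_one]

/-- Each register is `|K|⁻¹` times identity plus translation by `t`. Expanding the product, `S`
records the registers where the translation is chosen. -/
theorem tensorPower_cosetState_zpowers {t : K} (ht : orderOf t = 2) :
    tensorPower m (cosetState (Subgroup.zpowers t)) =
      ((Fintype.card K : ℂ) ^ m)⁻¹ • ∑ S : Finset (Fin m),
        rightTranslation (Fin m → K) (diagEmbed K S t) := by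
  classical
  have ht1 : t ≠ 1 := by
    rintro rfl
    simp at ht
  have hmem : ∀ z : K, z ∈ Subgroup.zpowers t ↔ z = t ∨ z = 1 := by
    intro z
    rw [← mem_powers_iff_mem_zpowers, mem_powers_iff_mem_range_orderOf, ht]
    simp [Finset.range_add_one, eq_comm]
  have hind : ∀ x y : K, (if x⁻¹ * y ∈ Subgroup.zpowers t then (1 : ℂ) else 0) =
      (if y = x * t then 1 else 0) + (if y = x then 1 else 0) := by
    intro x y
    have h1 : x⁻¹ * y ∈ Subgroup.zpowers t ↔ y = x * t ∨ y = x := by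
      rw [hmem, inv_mul_eq_iff_eq_mul, inv_mul_eq_one, eq_comm (a := x)]
    by_cases h2 : y = x
    · simp [h2, ht1]
    · simp [h1, h2]
  ext x y
  simp only [tensorPower, of_apply, cosetState_apply, Finset.prod_mul_distrib, Matrix.smul_apply,
    Matrix.sum_apply, rightTranslation_apply, hind, Fintype.prod_add]
  simp only [Finset.prod_const, Finset.card_univ, Fintype.card_fin, inv_pow, smul_eq_mul]
  congr 1
  refine Finset.sum_congr rfl fun S _ => ?_
  rw [Finset.prod_ite_zero, Finset.prod_ite_zero]
  simp only [Finset.prod_const_one, ite_mul, zero_mul, one_mul, ← ite_and]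
  congr 1
  rw [eq_iff_iff, funext_iff]
  constructor
  · rintro ⟨h1, h2⟩ j
    by_cases hj : j ∈ S
    · simpa [diagEmbed, hj] using h1 j hj
    · simpa [diagEmbed, hj] using h2 j (by simpa using hj)
  · intro h
    exact ⟨fun j hj => by simpa [diagEmbed, hj] using h j,
      fun j hj => by simpa [diagEmbed, Finset.mem_compl.mp hj] using h j⟩

/-- The contribution of the registers in `S` to the probability of an outcome. -/
noncomputable def registerCoeff {r : ℕ} (M : POVM (Fin m → K) r) (S : Finset (Fin m)) (i : Fin r)
    (y : K) : ℂ :=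
  ((((Fintype.card K : ℂ) ^ m)⁻¹ • M.effect i) *
    rightTranslation (Fin m → K) (diagEmbed K S y)).trace

theorem isPosDefFun_registerCoeff {r : ℕ} (M : POVM (Fin m → K) r) (S : Finset (Fin m))
    (i : Fin r) : IsPosDefFun (registerCoeff M S i) :=
  IsPosDefFun.trace_mul ((rightTranslation (Fin m → K)).comp (diagEmbed K S))
    (fun y => by simp only [MonoidHom.comp_apply, map_inv (diagEmbed K S), rightTranslation_inv])
    ((M.posSemidef i).smul (by positivity))

/-- The trace of a nontrivial translation vanishes. Nonemptiness of `S` makes the embedding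
injective, so only `y = 1` gives the trivial one. -/
theorem sum_registerCoeff {r : ℕ} (M : POVM (Fin m → K) r) {S : Finset (Fin m)}
    (hS : S.Nonempty) (y : K) : ∑ i, registerCoeff M S i y = if y = 1 then 1 else 0 := by
  have hK : (Fintype.card K : ℂ) ≠ 0 := by exact_mod_cast Fintype.card_ne_zero
  simp only [registerCoeff]
  rw [← trace_sum, ← Finset.sum_mul, ← Finset.smul_sum, M.sum_eq_one, Matrix.smul_mul, one_mul,
    trace_smul, trace_rightTranslation]
  simp [diagEmbed_eq_one_iff hS, hK]

theorem prob_sub_prob_bot {r : ℕ} (M : POVM (Fin m → K) r) (i : Fin r) {t : K}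
    (ht : orderOf t = 2) :
    M.prob (tensorPower m (cosetState (Subgroup.zpowers t))) i -
      M.prob (tensorPower m (cosetState ⊥)) i =
      (∑ S ∈ univ.erase ∅, registerCoeff M S i t).re := by
  have h1 : ∀ S : Finset (Fin m), ∀ y, (((((Fintype.card K : ℂ) ^ m)⁻¹ •
      rightTranslation (Fin m → K) (diagEmbed K S y)) * M.effect i).trace) =
      registerCoeff M S i y := by
    intro S y
    rw [registerCoeff, Matrix.smul_mul, Matrix.smul_mul, trace_smul, trace_smul, trace_mul_comm]
  have h2 : registerCoeff M ∅ i 1 = registerCoeff M ∅ i t := by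
    have : diagEmbed K (∅ : Finset (Fin m)) t = diagEmbed K ∅ 1 := by ext; simp [diagEmbed]
    rw [registerCoeff, registerCoeff, this]
  rw [POVM.prob, POVM.prob, tensorPower_cosetState_bot, tensorPower_cosetState_zpowers ht,
    Finset.smul_sum, Finset.sum_mul, trace_sum, ← Complex.sub_re]
  simp only [h1]
  rw [h2, ← Finset.add_sum_erase univ _ (mem_univ (∅ : Finset (Fin m))), add_sub_cancel_left]

/-- A measurement of `m` registers barely tells a random conjugate from the trivial subgroup. -/
theorem sum_abs_prob_sub_le {t : K} (ht : orderOf t = 2) {C : ℝ} (hC : 0 ≤ C)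
    (hf : ∀ (r : ℕ) (f : Fin r → K → ℂ), (∀ i, IsPosDefFun (f i)) →
      (∀ y, ∑ i, f i y = if y = 1 then 1 else 0) → ∑ g, ∑ i, ‖f i (g * t * g⁻¹)‖ ≤ C)
    {r : ℕ} (M : POVM (Fin m → K) r) :
    ∑ g : K, ∑ i, |M.prob (tensorPower m (cosetState
        ((Subgroup.zpowers t).map (MulAut.conj g).toMonoidHom))) i -
      M.prob (tensorPower m (cosetState ⊥)) i| ≤ m * 2 ^ m * C := by
  have hconj : ∀ g : K, orderOf (g * t * g⁻¹) = 2 := fun g => by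
    rw [← ht]
    exact MulEquiv.orderOf_eq (MulAut.conj g) t
  calc _ ≤ ∑ g : K, ∑ i, ∑ S ∈ univ.erase ∅, ‖registerCoeff M S i (g * t * g⁻¹)‖ := by
        refine Finset.sum_le_sum fun g _ => Finset.sum_le_sum fun i _ => ?_
        rw [map_conj_zpowers, prob_sub_prob_bot M i (hconj g)]
        exact (Complex.abs_re_le_norm _).trans (norm_sum_le _ _)
    _ = ∑ S ∈ univ.erase ∅, ∑ g : K, ∑ i, ‖registerCoeff M S i (g * t * g⁻¹)‖ := by
        rw [Finset.sum_congr rfl fun g _ => Finset.sum_comm, Finset.sum_comm]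
    _ ≤ ∑ S ∈ (univ : Finset (Finset (Fin m))).erase ∅, C := by
        refine Finset.sum_le_sum fun S hS => hf r _ (isPosDefFun_registerCoeff M S) ?_
        exact sum_registerCoeff M (Finset.nonempty_iff_ne_empty.mpr (Finset.ne_of_mem_erase hS))
    _ ≤ _ := by
        rw [Finset.sum_const, Finset.card_erase_of_mem (mem_univ _), nsmul_eq_mul]
        gcongr
        simp only [Finset.card_univ, Fintype.card_finset, Fintype.card_fin]
        -- The factor `m` in the bound is not needed for one measurement, except that it must vanish
        -- at `m = 0`; it makes the bounds add up to `numStates` along a run.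
        rcases Nat.eq_zero_or_pos m with rfl | hm
        · simp
        · have : 2 ^ m - 1 ≤ m * 2 ^ m := (Nat.sub_le _ _).trans (Nat.le_mul_of_pos_left _ hm)
          exact_mod_cast this

end Registers

/-! ### Adaptive algorithms -/

namespace CosetAlgorithm

variable {K : Type*} [Group K] [Fintype K] [DecidableEq K] {α : Type*} [DecidableEq α]

theorem outputProb_nonneg (H : Subgroup K) (A : CosetAlgorithm K α) (a : α) :
    0 ≤ A.outputProb H a := by
  induction A with
  | output b =>
    rw [outputProb]
    split_ifs <;> norm_num
  | measure m r M next ih =>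
    rw [outputProb]
    exact Finset.sum_nonneg fun i _ => mul_nonneg
      (M.prob_nonneg (tensorPower_posSemidef m (cosetState_posSemidef H)) i) (ih i)

theorem sum_prob_tensorPower {m r : ℕ} (M : POVM (Fin m → K) r) (H : Subgroup K) :
    ∑ i, M.prob (tensorPower m (cosetState H)) i = 1 := by
  rw [M.sum_prob, trace_tensorPower, trace_cosetState, one_pow, Complex.one_re]

theorem sum_outputProb [Fintype α] (H : Subgroup K) (A : CosetAlgorithm K α) :
    ∑ a, A.outputProb H a = 1 := by
  induction A with
  | output b => simp [outputProb]
  | measure m r M next ih =>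
    simp only [outputProb]
    rw [Finset.sum_comm]
    simp only [← Finset.mul_sum, ih, mul_one]
    exact sum_prob_tensorPower M H

/-- Hybrid step: replace the outcome distribution first, then the continuations. The latter are
weighted by the probabilities for `H'`, which do not vary when only `H` is averaged over conjugates.
-/
theorem sum_abs_outputProb_measure_le [Fintype α] {m r : ℕ} (M : POVM (Fin m → K) r)
    (next : Fin r → CosetAlgorithm K α) (H H' : Subgroup K) :
    ∑ a, |(measure m r M next).outputProb H a - (measure m r M next).outputProb H' a| ≤
      ∑ i, |M.prob (tensorPower m (cosetState H)) i - M.prob (tensorPower m (cosetState H')) i| +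
      ∑ i, M.prob (tensorPower m (cosetState H')) i *
        ∑ a, |(next i).outputProb H a - (next i).outputProb H' a| := by
  set p := M.prob (tensorPower m (cosetState H))
  set q := M.prob (tensorPower m (cosetState H')) with hq
  have hqnn : ∀ i, 0 ≤ q i :=
    fun i => M.prob_nonneg (tensorPower_posSemidef m (cosetState_posSemidef H')) i
  calc _ ≤ ∑ a, ∑ i, (|p i - q i| * (next i).outputProb H a +
        q i * |(next i).outputProb H a - (next i).outputProb H' a|) := by
        refine Finset.sum_le_sum fun a _ => ?_
        rw [outputProb, outputProb, ← Finset.sum_sub_distrib]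
        refine (Finset.abs_sum_le_sum_abs _ _).trans (Finset.sum_le_sum fun i _ => ?_)
        have h1 : p i * (next i).outputProb H a - q i * (next i).outputProb H' a =
            (p i - q i) * (next i).outputProb H a +
            q i * ((next i).outputProb H a - (next i).outputProb H' a) := by ring
        change |p i * (next i).outputProb H a - q i * (next i).outputProb H' a| ≤ _
        rw [h1]
        refine (abs_add_le _ _).trans (le_of_eq ?_)
        rw [abs_mul, abs_mul, abs_of_nonneg (hqnn i), abs_of_nonneg (outputProb_nonneg H _ a)]
    _ = _ := by
        rw [Finset.sum_comm]
        simp only [Finset.sum_add_distrib, ← Finset.mul_sum, sum_outputProb, mul_one]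

/-- The outcome weights belong to the trivial subgroup and do not depend on `g`, so the sum over `g`
passes inside to the continuations and induction applies. -/
theorem sum_conj_abs_outputProb_sub_le [Fintype α] {t : K} (ht : orderOf t = 2) {C : ℝ}
    (hC : 0 ≤ C)
    (hf : ∀ (r : ℕ) (f : Fin r → K → ℂ), (∀ i, IsPosDefFun (f i)) →
      (∀ y, ∑ i, f i y = if y = 1 then 1 else 0) → ∑ g, ∑ i, ‖f i (g * t * g⁻¹)‖ ≤ C)
    (A : CosetAlgorithm K α) :
    ∑ g : K, ∑ a, |A.outputProb ((Subgroup.zpowers t).map (MulAut.conj g).toMonoidHom) a -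
      A.outputProb ⊥ a| ≤ A.numStates * 2 ^ A.entanglement * C := by
  induction A with
  | output b => simp [outputProb, numStates]
  | measure m r M next ih =>
    set q := M.prob (tensorPower m (cosetState (⊥ : Subgroup K))) with hq
    have hqnn : ∀ i, 0 ≤ q i :=
      fun i => M.prob_nonneg (tensorPower_posSemidef m (cosetState_posSemidef ⊥)) i
    set N := Finset.univ.sup fun i => (next i).numStates with hN
    set E := max m (Finset.univ.sup fun i => (next i).entanglement) with hE
    have hnext : ∀ i, ((next i).numStates : ℝ) * 2 ^ (next i).entanglement * C ≤
        N * 2 ^ E * C := by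
      intro i
      have h1 : (next i).numStates ≤ N :=
        Finset.le_sup (f := fun i => (next i).numStates) (mem_univ i)
      have h2 : (next i).entanglement ≤ E :=
        (Finset.le_sup (f := fun i => (next i).entanglement) (mem_univ i)).trans
          (le_max_right _ _)
      gcongr
      norm_num
    calc _ ≤ ∑ g : K, (∑ i, |M.prob (tensorPower m (cosetState
              ((Subgroup.zpowers t).map (MulAut.conj g).toMonoidHom))) i - q i| +
            ∑ i, q i * ∑ a, |(next i).outputProb
              ((Subgroup.zpowers t).map (MulAut.conj g).toMonoidHom) a -
                (next i).outputProb ⊥ a|) :=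
          Finset.sum_le_sum fun g _ => sum_abs_outputProb_measure_le M next _ _
      _ ≤ m * 2 ^ m * C + ∑ i, q i * (N * 2 ^ E * C) := by
          rw [Finset.sum_add_distrib]
          refine add_le_add (sum_abs_prob_sub_le ht hC hf M) ?_
          rw [Finset.sum_comm]
          refine Finset.sum_le_sum fun i _ => ?_
          rw [← Finset.mul_sum]
          exact mul_le_mul_of_nonneg_left ((ih i).trans (hnext i)) (hqnn i)
      _ ≤ m * 2 ^ E * C + N * 2 ^ E * C := by
          rw [← Finset.sum_mul, hq, sum_prob_tensorPower, one_mul]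
          have h3 : m ≤ E := le_max_left _ _
          gcongr
          norm_num
      _ = _ := by
          rw [numStates, entanglement]
          push_cast
          ring

end CosetAlgorithm

end CosetHSP

open Filter in
theorem mainTheorem11 {G : Type*} [Group G] [Fintype G] [DecidableEq G] (h : G)
    (hh : orderOf h = 2)
    (hG : Real.sqrt (Fintype.card G) >
      Real.sqrt (Fintype.card (CosetHSP.IrrepClass G)) *
        ∑ σ ∈ CosetHSP.extremalIrreps h, (σ.dim : ℝ) ^ 2) :
    ∃ c : ℝ, 0 < c ∧ ∀ a b : ℕ, ∃ N : ℕ, ∀ n : ℕ, N ≤ n →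
      ∀ (α : Type) [Fintype α] [DecidableEq α] (A : CosetHSP.CosetAlgorithm (Fin n → G) α),
        A.numStates ≤ n ^ a →
        A.Distinguishes (Subgroup.zpowers (fun _ : Fin n => h)) (1 / (n : ℝ) ^ b) →
        c * n ≤ A.entanglement := by
  obtain ⟨β, hβ0, hβ1, hβ⟩ := CosetHSP.exists_exponential_bound h hG
  have hγ0 : 0 < Real.sqrt β := Real.sqrt_pos.mpr hβ0
  have hγ1 : Real.sqrt β < 1 := by rwa [Real.sqrt_lt' one_pos, one_pow]
  -- With this `c`, entanglement below `c * n` gives `2 ^ entanglement ≤ β ^ (-n / 2)`. Half of the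
  -- decay `β ^ n` survives and beats `n ^ (a + b)`.
  refine ⟨Real.logb 2 (Real.sqrt β)⁻¹,
    Real.logb_pos (by norm_num) ((one_lt_inv₀ hγ0).mpr hγ1), fun a b => ?_⟩
  have hlim := tendsto_pow_const_mul_const_pow_of_abs_lt_one (a + b)
    (show |Real.sqrt β| < 1 by rwa [abs_of_pos hγ0])
  -- The condition `1 ≤ n` ensures that the constant tuple is nontrivial, hence of order `2`.
  obtain ⟨N, hN⟩ := eventually_atTop.mp
    ((hlim.eventually (gt_mem_nhds one_pos)).and (eventually_ge_atTop 1))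
  refine ⟨N, fun n hn α _ _ A hA hdist => ?_⟩
  obtain ⟨hsmall, hn1⟩ := hN n hn
  by_contra hlt
  rw [not_le] at hlt
  have hK : (0 : ℝ) < Fintype.card (Fin n → G) := by exact_mod_cast Fintype.card_pos
  have hnpos : (0 : ℝ) < n := by exact_mod_cast hn1
  have ht : orderOf (fun _ : Fin n => h) = 2 := by
    refine orderOf_eq_prime ?_ fun h1 => ?_
    · ext
      simp [← hh, pow_orderOf_eq_one]
    · have h2 : h = 1 := congrFun h1 ⟨0, hn1⟩
      rw [h2, orderOf_one] at hh
      omega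
  have hmain := CosetHSP.CosetAlgorithm.sum_conj_abs_outputProb_sub_le ht (by positivity) (hβ n) A
  -- The advantage holds for every conjugate, hence on average; the `2` undoes the `1 / 2` in total
  -- variation.
  have hlow : Fintype.card (Fin n → G) * (2 * (1 / (n : ℝ) ^ b)) ≤
      ∑ g : Fin n → G, ∑ x, |A.outputProb ((Subgroup.zpowers fun _ : Fin n => h).map
        (MulAut.conj g).toMonoidHom) x - A.outputProb ⊥ x| := by
    rw [← nsmul_eq_mul, ← Finset.card_univ]
    refine Finset.card_nsmul_le_sum _ _ _ fun g _ => ?_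
    have h1 := hdist g
    rw [CosetHSP.CosetAlgorithm.totalVariation] at h1
    linarith
  have hent : (2 : ℝ) ^ A.entanglement ≤ (Real.sqrt β)⁻¹ ^ n := by
    rw [← Real.rpow_natCast, ← Real.rpow_natCast _ n]
    calc (2 : ℝ) ^ (A.entanglement : ℝ) ≤ 2 ^ (Real.logb 2 (Real.sqrt β)⁻¹ * n) :=
          Real.rpow_le_rpow_of_exponent_le (by norm_num) hlt.le
      _ = _ := by
          rw [Real.rpow_mul (by norm_num), Real.rpow_logb (by norm_num) (by norm_num)
            (inv_pos.mpr hγ0)]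
  have hfin : 1 / (n : ℝ) ^ b ≤ (n : ℝ) ^ a * Real.sqrt β ^ n := by
    have h1 : Fintype.card (Fin n → G) * (2 * (1 / (n : ℝ) ^ b)) ≤
        Fintype.card (Fin n → G) * (2 * ((n : ℝ) ^ a * Real.sqrt β ^ n)) := by
      calc _ ≤ A.numStates * 2 ^ A.entanglement * (Fintype.card (Fin n → G) * (2 * β ^ n)) :=
            hlow.trans hmain
        _ ≤ (n : ℝ) ^ a * (Real.sqrt β)⁻¹ ^ n *
            (Fintype.card (Fin n → G) * (2 * β ^ n)) := by
            gcongr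
            exact_mod_cast hA
        _ = _ := by
            have h2 : β ^ n = Real.sqrt β ^ n * Real.sqrt β ^ n := by
              rw [← mul_pow, Real.mul_self_sqrt hβ0.le]
            rw [h2, inv_pow]
            field_simp
    have h3 := le_of_mul_le_mul_left h1 hK
    linarith
  rw [div_le_iff₀ (by positivity)] at hfin
  rw [pow_add] at hsmall
  linarith
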